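/- **Setting.** For $f\in L^2(\mathbb R^d)$ (complex-valued) vanishing almost everywhere outside a compact set, write $\hat f(\xi)=\int_{\mathbb R^d} f(x)e^{-2\pi i\,\xi\cdot x}\,dx$, and let $|\cdot|$ be the Euclidean norm. A *centered symmetric convex body* $D\subseteq\mathbb R^d$ is a compact convex set with $0\in\operatorname{int}D$ and $D=-D$; its polar set is $D^\circ=\{z:\ x\cdot z\le 1\ \text{for all } x\in D\}$, which induces the norm $|x|_{D^\circ}=\inf\{a>0:\ x\in aD^\circ\}$. $L^2(D)$ is the space of $f\in L^2(\mathbb R^d)$ vanishing almost everywhere outside $D$. For a closed countable set $\Omega\subseteq\mathbb R^d$ let $$\delta_{D^\circ}(\Omega)=\sup_{z\in\mathbb R^d}\inf_{\omega\in\Omega}|\omega-z|_{D^\circ},$$ and let $$\mu_\omega=\operatorname{meas}\{z\in\mathbb R^d:\ |\omega-z|_{D^\circ}\le|\lambda-z|_{D^\circ}\ \text{for all }\lambda\in\Omega,\ \lambda\ne\omega\}\qquad(\omega\in\Omega)$$ be the Voronoi weights. For a linear subspace $\mathcal R\subseteq L^2(D)$ and $K>0$ put $$V_*(\mathcal R,K)=\sup_{f\in\mathcal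 R,\ \|f\|_2=1}\int_{|\xi|>K}|\hat f(\xi)|^2\,d\xi,\qquad V_*(\mathcal R,\Omega,K)=\sup_{f\in\mathcal R,\ \|f\|_2=1}\ \sum_{\omega\in\Omega,\ |\omega|>K}\mu_\omega|\hat f(\omega)|^2 ,$$ as elements of $[0,\infty]$ (a supremum over the empty set being $0$). Let $\alpha>0$. A sequence of subspaces $\{\mathcal R_N:N\ge1\}$ of $L^2(D)$ has *residual decay of order $\alpha$* if for every $\theta>0$ there is $c_\theta>0$ with $\sup_{N\ge1}V_*(\mathcal R_N,c_\theta N^\alpha)\le\theta$, and *residual decay of order $\alpha$ with respect to $\Omega$* if for every $\theta>0$ there is $c_\theta>0$ with $\sup_{N\ge1}V_*(\mathcal R_N,\Omega,c_\theta N^\alpha)\le\theta$. **Corollary 1.5.** Let $D\subseteq\mathbb R^d$ be a centered symmetric convex body, let $\{\mathcal R_N:N\ge1\}$ be a sequence of subspaces of $L^2(D)$, and let $\alpha>0$. (a) Let $\Omega\subseteq\mathbb R^d$ be a closed countable set with $\delta_{D^\circ}(\Omega)<1/4$. If $\{\mathcal R_N:N\ge1\}$ has residual decay of order $\alpha$ with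 respect to $\Omega$, then it has residual decay of order $\alpha$. (b) If $D=[-1/2,1/2]^d$ and $\{\mathcal R_N:N\ge1\}$ has residual decay of order $\alpha$ with respect to $\mathbb Z^d$, then it has residual decay of order $\alpha$. -/

import Mathlib

open MeasureTheory
open scoped ENNReal FourierTransform

noncomputable section

/-- A compact convex subset of `ℝ^d` with `0` in its interior and `D = -D`. -/
structure IsCenteredSymmetricConvexBody {d : ℕ} (D : Set (EuclideanSpace ℝ (Fin d))) : Prop where
  isCompact : IsCompact D
  convex : Convex ℝ D
  zero_mem_interior : (0 : EuclideanSpace ℝ (Fin d)) ∈ interior D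
  neg_mem : ∀ x ∈ D, -x ∈ D

/-- The polar set `D° = {z | ∀ x ∈ D, x · z ≤ 1}`. -/
def polarSet {d : ℕ} (D : Set (EuclideanSpace ℝ (Fin d))) : Set (EuclideanSpace ℝ (Fin d)) :=
  {z | ∀ x ∈ D, inner ℝ x z ≤ 1}

/-- The gap `sup_z inf_{ω ∈ Ω} |ω - z|_E` of `Ω`, where `|x|_E = gauge E x = inf {a > 0 | x ∈ a E}`.
It is `∞` for empty `Ω`. -/
def gap {d : ℕ} (E Ω : Set (EuclideanSpace ℝ (Fin d))) : ℝ≥0∞ :=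
  ⨆ z : EuclideanSpace ℝ (Fin d), ⨅ ω ∈ Ω, ENNReal.ofReal (gauge E (ω - z))

/-- The Voronoi region of `ω` in `Ω`, with respect to the norm `|x|_E = gauge E x`. -/
def voronoiRegion {d : ℕ} (E Ω : Set (EuclideanSpace ℝ (Fin d))) (ω : EuclideanSpace ℝ (Fin d)) :
    Set (EuclideanSpace ℝ (Fin d)) :=
  {z | ∀ l ∈ Ω, l ≠ ω → gauge E (ω - z) ≤ gauge E (l - z)}

/-- The Voronoi weight of `ω`: the Lebesgue measure of its Voronoi region. -/
def voronoiWeight {d : ℕ} (E Ω : Set (EuclideanSpace ℝ (Fin d))) (ω : EuclideanSpace ℝ (Fin d)) :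
    ℝ≥0∞ :=
  volume (voronoiRegion E Ω ω)

/-- `L²(D)`: the subspace of the complex space `L²(ℝ^d)` of functions vanishing almost everywhere
outside `D`. -/
def L2On {d : ℕ} (D : Set (EuclideanSpace ℝ (Fin d))) :
    Submodule ℂ (Lp ℂ 2 (volume : Measure (EuclideanSpace ℝ (Fin d)))) where
  carrier := {f | ∀ᵐ x : EuclideanSpace ℝ (Fin d), x ∉ D → f x = 0}
  zero_mem' := by
    filter_upwards [Lp.coeFn_zero ℂ 2 (volume : Measure (EuclideanSpace ℝ (Fin d)))] with x hx hxD
    exact hx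
  add_mem' := by
    intro f g hf hg
    filter_upwards [hf, hg, Lp.coeFn_add f g] with x h1 h2 h3 hx
    rw [h3, Pi.add_apply, h1 hx, h2 hx, add_zero]
  smul_mem' := by
    intro c f hf
    filter_upwards [hf, Lp.coeFn_smul c f] with x h1 h2 hx
    rw [h2, Pi.smul_apply, h1 hx, smul_zero]

/-- The Fourier transform `ξ ↦ ∫ f(x) exp(-2πi ξ·x) dx` of `f`, as a function defined pointwise by
the integral, which converges when `f` vanishes outside a set of finite measure. -/
def fourierFn {d : ℕ} (f : Lp ℂ 2 (volume : Measure (EuclideanSpace ℝ (Fin d))))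
    (ξ : EuclideanSpace ℝ (Fin d)) : ℂ :=
  𝓕 (fun x : EuclideanSpace ℝ (Fin d) => f x) ξ

/-- The intrinsic residual `sup {∫_{|ξ| > K} |f̂(ξ)|² dξ : f ∈ R, ‖f‖ = 1}`. -/
def intrinsicResidual {d : ℕ} (R : Submodule ℂ (Lp ℂ 2 (volume : Measure (EuclideanSpace ℝ (Fin d)))))
    (K : ℝ) : ℝ≥0∞ :=
  ⨆ f ∈ R, ⨆ _ : ‖f‖ = 1,
    ∫⁻ ξ in {ξ : EuclideanSpace ℝ (Fin d) | K < ‖ξ‖}, ‖fourierFn f ξ‖ₑ ^ 2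

/-- The residual `sup {∑_{ω ∈ Ω, |ω| > K} μ_ω |f̂(ω)|² : f ∈ R, ‖f‖ = 1}` of the sampling set `Ω`,
with the Voronoi weights of `Ω` for the norm induced by the polar set of `D`. -/
def samplingResidual {d : ℕ} (D : Set (EuclideanSpace ℝ (Fin d)))
    (R : Submodule ℂ (Lp ℂ 2 (volume : Measure (EuclideanSpace ℝ (Fin d)))))
    (Ω : Set (EuclideanSpace ℝ (Fin d))) (K : ℝ) : ℝ≥0∞ :=
  ⨆ f ∈ R, ⨆ _ : ‖f‖ = 1,
    ∑' ω : {ω : EuclideanSpace ℝ (Fin d) // ω ∈ Ω ∧ K < ‖ω‖},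
      voronoiWeight (polarSet D) Ω ω.1 * ‖fourierFn f ω.1‖ₑ ^ 2

/-- Residual decay of order `α` of the sequence `R 1, R 2, …`. -/
def HasResidualDecay {d : ℕ}
    (R : ℕ → Submodule ℂ (Lp ℂ 2 (volume : Measure (EuclideanSpace ℝ (Fin d))))) (α : ℝ) : Prop :=
  ∀ θ : ℝ, 0 < θ → ∃ c : ℝ, 0 < c ∧
    (⨆ (N : ℕ) (_ : 1 ≤ N), intrinsicResidual (R N) (c * (N : ℝ) ^ α)) ≤ ENNReal.ofReal θ

/-- Residual decay of order `α` of the sequence `R 1, R 2, …` with respect to the set `Ω`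
(for the spectrum `D`). -/
def HasResidualDecayWrt {d : ℕ} (D : Set (EuclideanSpace ℝ (Fin d)))
    (R : ℕ → Submodule ℂ (Lp ℂ 2 (volume : Measure (EuclideanSpace ℝ (Fin d)))))
    (Ω : Set (EuclideanSpace ℝ (Fin d))) (α : ℝ) : Prop :=
  ∀ θ : ℝ, 0 < θ → ∃ c : ℝ, 0 < c ∧
    (⨆ (N : ℕ) (_ : 1 ≤ N), samplingResidual D (R N) Ω (c * (N : ℝ) ^ α)) ≤ ENNReal.ofReal θ

/-- The cube `[-1/2, 1/2]^d`. -/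
def unitCube (d : ℕ) : Set (EuclideanSpace ℝ (Fin d)) :=
  {x | ∀ i, x i ∈ Set.Icc (-1 / 2 : ℝ) (1 / 2)}

/-- The integer lattice `ℤ^d` in `ℝ^d`. -/
def integerLattice (d : ℕ) : Set (EuclideanSpace ℝ (Fin d)) :=
  {x | ∀ i, ∃ n : ℤ, x i = n}

end

/-! Both parts bound the high-frequency energy of f by its high-frequency samples plus a small
error, moving the frequency threshold only by a constant or by a factor. This loss is harmless for
thresholds of the form c N^α with N ≥ 1.

(a) Let q be the gauge of the polar set and let φ be a normalized bump on a tiny ball. For fixed ξ,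
the function G(y) = f̂(y) φ̂(y - ξ) is the Fourier transform of a function supported in a slight
enlargement of D, and it is concentrated near ξ. By a sharp Bernstein-type inequality
(`cos_mul_norm_integral_le_norm_integral_mul_exp`), a function of exponential type s whose modulus
is largest at 0 satisfies |G(1)| ≥ cos s |G(0)|. Hence |G| stays comparable to its maximum on a
q-ball around the maximum point z. A gap below 1/4 makes this radius large enough for every Voronoi
cell near z to have its sample point in that ball, with s < π/2 and so cos s > 0. Therefore |f̂(ξ)|²
is at most a constant times the sum of μ_ω |f̂(ω)|² |φ̂(ω - ξ)|². Now integrate over |ξ| > K + M.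
Samples with |ω| > K give the sampling residual. The others see only the tail of φ̂ beyond M, and
their total weight is bounded by a Plancherel–Pólya type inequality
(`exists_tsum_measure_mul_enorm_sq_fourier_le`).

(b) For the cube the gauge is half the ℓ¹ norm, so the gap of ℤ^d is d/4 and (a) does not apply when
d ≥ 1. Instead the exponentials of integer frequency form an orthonormal basis of L² of the cube.
Subtract from f its Fourier partial sum over a box of side about 2L. By Parseval the remainder is
controlled by the samples outside the box, since every Voronoi weight is at least 1. The partial sum
has little energy where some |ξ_i| > M: its truncated Gram matrix has entries at most 8/M and is
supported on pairs of frequencies differing only in coordinate i, so a Schur test gives the factor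
8(2L + 1)/M. Taking M a large multiple of L finishes the proof. -/

/-! ### An interpolation formula and the sharp Bernstein-type inequality. -/

theorem summable_div_mul_int_mul_pi_sub {s : ℝ} (hs : 0 < s) (hs' : s < Real.pi) :
    Summable fun k : ℤ => s / (k * Real.pi * (k * Real.pi - s)) := by
  have hpi := Real.pi_pos
  have h2 : Summable fun k : ℤ => s / (Real.pi * (Real.pi - s)) * (1 / (k : ℝ) ^ 2) :=
    (Real.summable_one_div_int_pow.2 one_lt_two).mul_left _
  refine h2.of_norm_bounded fun k => ?_
  rcases eq_or_ne k 0 with rfl | hk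
  · simp
  have hk1 : (1 : ℝ) ≤ |(k : ℝ)| := by exact_mod_cast Int.one_le_abs hk
  have h3 : |(k : ℝ)| * (Real.pi - s) ≤ |k * Real.pi - s| := by
    have h4 := abs_sub_abs_le_abs_sub ((k : ℝ) * Real.pi) s
    rw [abs_mul, abs_of_pos hpi, abs_of_pos hs] at h4
    nlinarith
  have h5 : 0 < |(k : ℝ)| * (Real.pi - s) := mul_pos (by linarith) (by linarith)
  rw [Real.norm_eq_abs, abs_div, abs_of_pos hs, abs_mul, abs_mul, abs_of_pos hpi, div_mul_div_comm,
    mul_one]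
  refine div_le_div_of_nonneg_left hs.le ?_ ?_
  · have : (0 : ℝ) < (k : ℝ) ^ 2 := by positivity
    have : 0 < Real.pi - s := by linarith
    positivity
  · rw [← sq_abs]
    nlinarith [mul_le_mul_of_nonneg_left h3 (by positivity : 0 ≤ |(k : ℝ)| * Real.pi)]

/-- For 0 < s < π the numbers kπ and kπ - s have the same sign when k ≠ 0. At k = 0 the quotient is
0 by the convention for division by zero, and this is the correct value of the zeroth Fourier
coefficient below. -/
theorem div_mul_int_mul_pi_sub_nonneg {s : ℝ} (hs : 0 < s) (hs' : s < Real.pi) (k : ℤ) :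
    0 ≤ s / (k * Real.pi * (k * Real.pi - s)) := by
  have hpi := Real.pi_pos
  refine div_nonneg hs.le ?_
  rcases lt_trichotomy k 0 with hk | rfl | hk
  · have : (k : ℝ) ≤ -1 := by exact_mod_cast Int.le_sub_one_of_lt hk
    exact mul_nonneg_of_nonpos_of_nonpos (by nlinarith) (by nlinarith)
  · simp
  · have : (1 : ℝ) ≤ k := by exact_mod_cast hk
    exact mul_nonneg (by nlinarith) (by nlinarith)

/-- The Fourier coefficients on `[-1, 1]` of `θ ↦ exp (iθs) / sin s - iθ - 1 / s`. -/
theorem integral_exp_neg_mul_sub {s : ℝ} (hs : 0 < s) (hs' : s < Real.pi) (n : ℤ) :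
    ∫ x in (-1 : ℝ)..1, Complex.exp (-(n * Real.pi * Complex.I * x)) *
      (Complex.exp (s * Complex.I * x) / Real.sin s - Complex.I * x - 1 / s) =
      2 * (-((-1) ^ n * ((s / (n * Real.pi * (n * Real.pi - s)) : ℝ) : ℂ))) := by
  have hsin : (Real.sin s : ℂ) ≠ 0 :=
    Complex.ofReal_ne_zero.2 (Real.sin_pos_of_pos_of_lt_pi hs hs').ne'
  have hs0 : (s : ℂ) ≠ 0 := Complex.ofReal_ne_zero.2 hs.ne'
  have hI := Complex.I_ne_zero
  have hcont : Continuous fun x : ℝ => Complex.exp (-(n * Real.pi * Complex.I * x)) *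
      (Complex.exp (s * Complex.I * x) / Real.sin s - Complex.I * x - 1 / s) := by fun_prop
  have hE : Complex.exp (s * Complex.I) - Complex.exp (-(s * Complex.I))
      = 2 * Complex.I * Real.sin s := by
    rw [Complex.ofReal_sin, Complex.sin]
    ring_nf
    rw [Complex.I_sq]; ring
  have hder : ∀ (c : ℂ) (x : ℝ), HasDerivAt (fun y : ℝ => Complex.exp (c * y))
      (c * Complex.exp (c * x)) x := fun c x => by
    have h1 : HasDerivAt (fun y : ℝ => c * (y : ℂ)) c x := by
      simpa using (Complex.ofRealCLM.hasDerivAt (x := x)).const_mul c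
    simpa [mul_comm] using h1.cexp
  have hid : ∀ x : ℝ, HasDerivAt (fun y : ℝ => (y : ℂ)) 1 x := fun x => by
    simpa using (hasDerivAt_id x).ofReal_comp
  rcases eq_or_ne n 0 with rfl | hn
  · have h := intervalIntegral.integral_eq_sub_of_hasDerivAt (a := -1) (b := 1)
      (f := fun x : ℝ => Complex.exp (s * Complex.I * x) / (s * Complex.I) / Real.sin s
        - Complex.I * (x : ℂ) ^ 2 / 2 - x / s)
      (f' := fun x : ℝ => Complex.exp (-(((0 : ℤ) : ℂ) * Real.pi * Complex.I * x)) *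
      (Complex.exp (s * Complex.I * x) / Real.sin s - Complex.I * x - 1 / s))
      (fun x _ => by
        have h1 := ((((hder (s * Complex.I) x).div_const (s * Complex.I)).div_const
          (Real.sin s : ℂ)).sub ((((hid x).pow 2).const_mul Complex.I).div_const 2)).sub
          ((hid x).div_const (s : ℂ))
        refine h1.congr_deriv ?_
        simp only [Int.cast_zero, zero_mul, neg_zero, Complex.exp_zero, one_mul]
        field_simp
        ring) (hcont.intervalIntegrable _ _)
    rw [h]
    push_cast
    have : s * Complex.I * (-1 : ℂ) = -(s * Complex.I) := by ring
    rw [this, mul_one]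
    have h2 : Complex.exp (s * Complex.I) =
      Complex.exp (-(s * Complex.I)) + 2 * Complex.I * Real.sin s := by rw [← hE]; ring
    rw [h2]
    push_cast at hsin ⊢
    field_simp
    ring
  · have hpi : (Real.pi : ℂ) ≠ 0 := Complex.ofReal_ne_zero.2 Real.pi_ne_zero
    have hn' : (n : ℂ) ≠ 0 := Int.cast_ne_zero.2 hn
    have hns : (n * Real.pi - s : ℂ) ≠ 0 := by
      have : (n * Real.pi - s : ℝ) ≠ 0 := by
        intro h0
        have h1 : (n : ℝ) * Real.pi = s := by linarith
        have h2 : (0 : ℝ) < n := by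
          by_contra h3; nlinarith [Real.pi_pos]
        have h4 : (1 : ℝ) ≤ n := by exact_mod_cast h2
        nlinarith [Real.pi_pos]
      exact_mod_cast this
    set c : ℂ := -(n * Real.pi * Complex.I) with hc
    have hc0 : c ≠ 0 := neg_ne_zero.2 (mul_ne_zero (mul_ne_zero hn' hpi) hI)
    have hcs : c + s * Complex.I ≠ 0 := by
      have : c + s * Complex.I = -((n * Real.pi - s) * Complex.I) := by rw [hc]; ring
      rw [this]; exact neg_ne_zero.2 (mul_ne_zero hns hI)
    have h := intervalIntegral.integral_eq_sub_of_hasDerivAt (a := -1) (b := 1)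
      (f := fun x : ℝ => Complex.exp ((c + s * Complex.I) * x) / (c + s * Complex.I) / Real.sin s
        - Complex.I * (Complex.exp (c * x) * (x / c - 1 / c ^ 2)) - Complex.exp (c * x) / c / s)
      (f' := fun x : ℝ => Complex.exp (-(n * Real.pi * Complex.I * x)) *
      (Complex.exp (s * Complex.I * x) / Real.sin s - Complex.I * x - 1 / s))
      (fun x _ => by
        have h1 := ((((hder (c + s * Complex.I) x).div_const (c + s * Complex.I)).div_const
          (Real.sin s : ℂ)).sub (((hder c x).mul
            (((hid x).div_const c).sub_const (1 / c ^ 2))).const_mul Complex.I)).sub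
          (((hder c x).div_const c).div_const (s : ℂ))
        refine h1.congr_deriv ?_
        have : (-(n * Real.pi * Complex.I * x) : ℂ) = c * x := by rw [hc]; ring
        rw [this, mul_div_cancel_left₀ _ hcs, add_mul, Complex.exp_add]
        field_simp
        ring) (hcont.intervalIntegrable _ _)
    rw [h]
    have e1 : Complex.exp c = (-1) ^ n := by
      have : c = (n : ℂ) * (-(Real.pi * Complex.I)) := by rw [hc]; ring
      rw [this, Complex.exp_int_mul, Complex.exp_neg, Complex.exp_pi_mul_I]
      norm_num
    have e2 : Complex.exp (-c) = (-1) ^ n := by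
      have : -c = (n : ℂ) * (Real.pi * Complex.I) := by rw [hc]; ring
      rw [this, Complex.exp_int_mul, Complex.exp_pi_mul_I]
    push_cast
    have e3 : (c + s * Complex.I) * (-1 : ℂ) = -c + -(s * Complex.I) := by ring
    have e4 : c * (-1 : ℂ) = -c := by ring
    rw [e3, mul_one, mul_one, e4, Complex.exp_add, Complex.exp_add, e1, e2]
    have h2 : Complex.exp (s * Complex.I) =
      Complex.exp (-(s * Complex.I)) + 2 * Complex.I * Real.sin s := by rw [← hE]; ring
    rw [h2]
    have e5 : c + s * Complex.I = -((n * Real.pi - s) * Complex.I) := by rw [hc]; ring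
    rw [e5, hc]
    generalize ((-1 : ℂ)) ^ n = u
    push_cast at hsin ⊢
    field_simp
    ring

/-- The function exp(iθs)/sin s jumps by 2i between -1 and 1, exactly like iθ. Subtracting iθ leaves
a continuous 2-periodic function, and subtracting 1/s removes its mean. The coefficients are then
absolutely summable, so the Fourier series converges at every point, endpoints included. -/
theorem hasSum_exp_mul_div_sin {s : ℝ} (hs : 0 < s) (hs' : s < Real.pi) {θ : ℝ}
    (hθ : θ ∈ Set.Icc (-1 : ℝ) 1) :
    HasSum (fun k : ℤ => -((-1) ^ k * ((s / (k * Real.pi * (k * Real.pi - s)) : ℝ) : ℂ)) *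
        Complex.exp (k * Real.pi * Complex.I * θ))
      (Complex.exp (s * Complex.I * θ) / Real.sin s - Complex.I * θ - 1 / s) := by
  have hsin : (Real.sin s : ℂ) ≠ 0 :=
    Complex.ofReal_ne_zero.2 (Real.sin_pos_of_pos_of_lt_pi hs hs').ne'
  have : Fact ((0 : ℝ) < 2) := ⟨two_pos⟩
  set H : ℝ → ℂ := fun θ => Complex.exp (s * Complex.I * θ) / Real.sin s - Complex.I * θ - 1 / s
    with hH
  have hHc : Continuous H := by rw [hH]; fun_prop
  have hE : Complex.exp (s * Complex.I) - Complex.exp (-(s * Complex.I))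
      = 2 * Complex.I * Real.sin s := by
    rw [Complex.ofReal_sin, Complex.sin]
    ring_nf
    rw [Complex.I_sq]; ring
  have hper : H (-1) = H (-1 + 2) := by
    have e : (-1 + 2 : ℝ) = 1 := by norm_num
    have : s * Complex.I * (-1 : ℂ) = -(s * Complex.I) := by ring
    simp only [hH, e]
    push_cast
    rw [this, mul_one]
    have h2 : Complex.exp (s * Complex.I) =
      Complex.exp (-(s * Complex.I)) + 2 * Complex.I * Real.sin s := by rw [← hE]; ring
    rw [h2]
    push_cast at hsin ⊢
    field_simp
    ring
  let f : C(AddCircle (2 : ℝ), ℂ) :=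
    ⟨AddCircle.liftIco 2 (-1) H, AddCircle.liftIco_continuous hper hHc.continuousOn⟩
  have hcoef : ∀ k : ℤ, fourierCoeff f k =
      -((-1) ^ k * ((s / (k * Real.pi * (k * Real.pi - s)) : ℝ) : ℂ)) := by
    intro k
    have h1 : fourierCoeff f k = fourierCoeff (AddCircle.liftIco 2 (-1) H) k := rfl
    rw [h1, fourierCoeff_liftIco_eq, fourierCoeffOn_eq_integral]
    have e : (-1 + 2 : ℝ) = 1 := by norm_num
    rw [e]
    have h2 : ∀ x : ℝ, (fourier (-k) (x : AddCircle ((1 : ℝ) - -1)) : ℂ) • H x =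
        Complex.exp (-(k * Real.pi * Complex.I * x)) *
      (Complex.exp (s * Complex.I * x) / Real.sin s - Complex.I * x - 1 / s) := by
      intro x
      rw [fourier_coe_apply, smul_eq_mul]
      congr 2
      push_cast
      ring
    simp_rw [h2]
    rw [integral_exp_neg_mul_sub hs hs' k, Complex.real_smul]
    push_cast
    ring
  have hsum : Summable (fourierCoeff f) := by
    refine Summable.of_norm ?_
    have : (fun k => ‖fourierCoeff f k‖) =
        fun k : ℤ => s / (k * Real.pi * (k * Real.pi - s)) := by
      ext k
      rw [hcoef, norm_neg, norm_mul, norm_zpow, norm_neg, norm_one, one_zpow, one_mul,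
        Complex.norm_real, Real.norm_of_nonneg (div_mul_int_mul_pi_sub_nonneg hs hs' k)]
    rw [this]
    exact summable_div_mul_int_mul_pi_sub hs hs'
  have h := has_pointwise_sum_fourier_series_of_summable hsum (θ : AddCircle (2 : ℝ))
  have hval : f (θ : AddCircle (2 : ℝ)) = H θ := by
    -- The lift to the circle reads values on [-1, 1), so θ = 1 is evaluated at -1 and `hper` brings
    -- the value back.
    rcases eq_or_lt_of_le hθ.2 with h1 | h1
    · have h3 : ((θ : ℝ) : AddCircle (2 : ℝ)) = ((-1 : ℝ) : AddCircle (2 : ℝ)) := by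
        rw [h1, ← AddCircle.coe_add_period (2 : ℝ) (-1)]; norm_num
      have h4 : f ((-1 : ℝ) : AddCircle (2 : ℝ)) = H (-1) :=
        AddCircle.liftIco_coe_apply (p := (2 : ℝ)) (a := (-1 : ℝ)) (f := H) ⟨le_refl _, by norm_num⟩
      rw [h3, h4, hper, h1]; norm_num
    · exact AddCircle.liftIco_coe_apply (p := (2 : ℝ)) (a := (-1 : ℝ)) (f := H) ⟨hθ.1, by linarith⟩
  rw [hval] at h
  refine h.congr_fun fun k => ?_
  rw [hcoef, fourier_coe_apply, smul_eq_mul]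
  congr 2
  push_cast
  ring

/-- Real part of the expansion at θ = 1, where exp(ikπ) cancels the alternating sign. It supplies
the exact total mass of the interpolation coefficients, which makes the cosine constant below sharp.
-/
theorem hasSum_div_mul_int_mul_pi_sub {s : ℝ} (hs : 0 < s) (hs' : s < Real.pi) :
    HasSum (fun k : ℤ => s / (k * Real.pi * (k * Real.pi - s)))
      (1 / s - Real.cos s / Real.sin s) := by
  have h := Complex.hasSum_re (hasSum_exp_mul_div_sin hs hs' (θ := 1) (by simp))
  have e1 : (Complex.exp (s * Complex.I * (1 : ℝ)) / Real.sin s - Complex.I * (1 : ℝ) - 1 / s).re =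
      -(1 / s - Real.cos s / Real.sin s) := by
    have : (1 / s : ℂ) = ((1 / s : ℝ) : ℂ) := by push_cast; rfl
    rw [Complex.ofReal_one, mul_one, mul_one, Complex.sub_re, Complex.sub_re, Complex.I_re,
      Complex.div_ofReal_re, Complex.exp_ofReal_mul_I_re, this, Complex.ofReal_re]
    ring
  rw [e1] at h
  have h' := h.neg
  rw [neg_neg] at h'
  refine h'.congr_fun fun k => ?_
  have e2 : Complex.exp (k * Real.pi * Complex.I * (1 : ℝ)) = (-1) ^ k := by
    have : (k * Real.pi * Complex.I * (1 : ℝ) : ℂ) = (k : ℂ) * (Real.pi * Complex.I) := by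
      push_cast; ring
    rw [this, Complex.exp_int_mul, Complex.exp_pi_mul_I]
  have e3 : (-1 : ℂ) ^ k * (-1) ^ k = 1 := by rw [← mul_zpow]; simp
  rw [e2, ← Complex.neg_re, neg_mul, neg_neg]
  generalize s / (k * Real.pi * (k * Real.pi - s)) = a
  rw [show (-1 : ℂ) ^ k * a * (-1) ^ k = (-1) ^ k * (-1) ^ k * a by ring, e3, one_mul,
    Complex.ofReal_re]

/-- If `t ↦ ∫ g exp(ipt)` with `|p| ≤ s` is largest in modulus at `t = 0`, then near `0` it is at
least as large as the cosine of frequency `s`. -/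
theorem cos_mul_norm_integral_le_norm_integral_mul_exp {X : Type*} [MeasurableSpace X]
    {μ : Measure X} {g : X → ℂ} (hg : Integrable g μ) {p : X → ℝ} (hp : Measurable p) {s : ℝ}
    (hs : 0 < s) (hs' : s < Real.pi) (hps : ∀ᵐ x ∂μ, g x ≠ 0 → |p x| ≤ s)
    (hmax : ∀ t : ℝ, ‖∫ x, g x * Complex.exp (p x * Complex.I * t) ∂μ‖ ≤ ‖∫ x, g x ∂μ‖) :
    Real.cos s * ‖∫ x, g x ∂μ‖ ≤ ‖∫ x, g x * Complex.exp (p x * Complex.I) ∂μ‖ := by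
  have hsin := Real.sin_pos_of_pos_of_lt_pi hs hs'
  set G : ℝ → ℂ := fun t => ∫ x, g x * Complex.exp (p x * Complex.I * t) ∂μ with hG
  have hG0 : G 0 = ∫ x, g x ∂μ := by simp [hG]
  have hG1 : G 1 = ∫ x, g x * Complex.exp (p x * Complex.I) ∂μ := by simp [hG]
  rw [← hG0, ← hG1]
  rw [← hG0] at hmax
  replace hmax : ∀ t, ‖G t‖ ≤ ‖G 0‖ := hmax
  have hnorm : ∀ (x : X) (t : ℝ), ‖Complex.exp (p x * Complex.I * t)‖ = 1 := fun x t => by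
    have : (p x * Complex.I * t : ℂ) = ((p x * t : ℝ) : ℂ) * Complex.I := by push_cast; ring
    rw [this, Complex.norm_exp_ofReal_mul_I]
  have hmeas : ∀ t : ℝ, AEStronglyMeasurable (fun x => Complex.exp (p x * Complex.I * t)) μ :=
    fun t => (by fun_prop : Measurable fun x => Complex.exp (p x * Complex.I * t)).aestronglyMeasurable
  have hint : ∀ t : ℝ, Integrable (fun x => g x * Complex.exp (p x * Complex.I * t)) μ :=
    fun t => hg.mul_bdd (c := 1) (hmeas t) (Filter.Eventually.of_forall fun x => (hnorm x t).le)
  have hbd : ∀ᵐ x ∂μ, ‖g x * (p x * Complex.I)‖ ≤ s * ‖g x‖ := by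
    filter_upwards [hps] with x hx
    by_cases h0 : g x = 0
    · simp [h0]
    · rw [norm_mul, norm_mul, Complex.norm_I, mul_one, Complex.norm_real, Real.norm_eq_abs,
        mul_comm]
      exact mul_le_mul_of_nonneg_right (hx h0) (norm_nonneg _)
  have hgp : Integrable (fun x => g x * (p x * Complex.I)) μ :=
    (hg.norm.const_mul s).mono' (hg.1.mul
      (by fun_prop : Measurable fun x => (p x * Complex.I : ℂ)).aestronglyMeasurable) hbd
  set G' : ℂ := ∫ x, g x * (p x * Complex.I) ∂μ with hG'
  have hder : HasDerivAt G G' 0 := by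
    have h := hasDerivAt_integral_of_dominated_loc_of_deriv_le (μ := μ) (𝕜 := ℝ)
      (F := fun t x => g x * Complex.exp (p x * Complex.I * t))
      (F' := fun t x => g x * (p x * Complex.I) * Complex.exp (p x * Complex.I * t))
      (x₀ := 0) (s := Set.univ) (bound := fun x => s * ‖g x‖) Filter.univ_mem
      (Filter.Eventually.of_forall fun t => (hint t).1) (hint 0)
      ((hgp.1.mul (hmeas 0)))
      (by
        filter_upwards [hbd] with x hx t _
        rw [norm_mul, hnorm, mul_one]; exact hx)
      (hg.norm.const_mul s)
      (Filter.Eventually.of_forall fun x t _ => by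
        have h1 : HasDerivAt (fun y : ℝ => (p x * Complex.I) * (y : ℂ)) (p x * Complex.I) t := by
          simpa using (Complex.ofRealCLM.hasDerivAt (x := t)).const_mul (p x * Complex.I)
        refine (h1.cexp.const_mul (g x)).congr_deriv ?_
        ring)
    have h2 := h.2
    simpa [hG, hG'] using h2
  set w : ℂ := (starRingEnd ℂ) (G 0) with hw
  have hwn : ‖w‖ = ‖G 0‖ := by rw [hw, RCLike.norm_conj]
  have hwG : (w * G 0).re = ‖G 0‖ ^ 2 := by
    rw [hw, mul_comm, Complex.mul_conj, Complex.ofReal_re, Complex.normSq_eq_norm_sq]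
  -- With w the conjugate of G(0), the function Re(w G(t)) is at most |G(0)|² with equality at 0, so
  -- its derivative vanishes there. This removes the derivative term from the interpolation formula.
  have hder0 : (w * G').re = 0 := by
    have h1 : HasDerivAt (fun t => (w * G t).re) (w * G').re 0 := by
      exact (Complex.reCLM.hasFDerivAt (x := w * G 0)).comp_hasDerivAt 0 (hder.const_mul w)
    have h2 : IsLocalMax (fun t => (w * G t).re) 0 := by
      refine Filter.Eventually.of_forall fun t => ?_
      show (w * G t).re ≤ (w * G 0).re
      rw [hwG]
      refine (Complex.re_le_norm _).trans ?_
      rw [norm_mul, hwn, sq]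
      exact mul_le_mul_of_nonneg_left (hmax t) (norm_nonneg _)
    rw [← h1.deriv, h2.deriv_eq_zero]
  set a : ℤ → ℝ := fun k => s / (k * Real.pi * (k * Real.pi - s)) with ha
  have ha0 : ∀ k, 0 ≤ a k := div_mul_int_mul_pi_sub_nonneg hs hs'
  have hs0 : (s : ℂ) ≠ 0 := Complex.ofReal_ne_zero.2 hs.ne'
  -- Integrate against g the exponential expansion taken at θ = p/s, which lies in [-1, 1] wherever
  -- g ≠ 0. This expresses G(1) through G(0), G'(0) and the values G(kπ/s).
  have hsum : HasSum (fun k : ℤ => -((-1) ^ k * ((a k : ℝ) : ℂ)) * G (k * Real.pi / s))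
      (G 1 / Real.sin s - G' / s - G 0 / s) := by
    have h := hasSum_integral_of_summable_integral_norm (μ := μ)
      (F := fun (k : ℤ) x => -((-1) ^ k * ((a k : ℝ) : ℂ)) *
        (g x * Complex.exp (p x * Complex.I * ((k * Real.pi / s : ℝ) : ℂ))))
      (fun k => (hint _).const_mul _)
      (by
        have : (fun k : ℤ => ∫ x, ‖-((-1) ^ k * ((a k : ℝ) : ℂ)) *
          (g x * Complex.exp (p x * Complex.I * ((k * Real.pi / s : ℝ) : ℂ)))‖ ∂μ) =
            fun k => a k * ∫ x, ‖g x‖ ∂μ := by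
          ext k
          rw [← integral_const_mul]
          congr 1
          ext x
          rw [norm_mul, norm_neg, norm_mul, norm_zpow, norm_neg, norm_one, one_zpow, one_mul,
            Complex.norm_real, Real.norm_of_nonneg (ha0 k), norm_mul, hnorm, mul_one]
        rw [this]
        exact (summable_div_mul_int_mul_pi_sub hs hs').mul_right _)
    have hE : (∫ x, ∑' k : ℤ, -((-1) ^ k * ((a k : ℝ) : ℂ)) *
        (g x * Complex.exp (p x * Complex.I * ((k * Real.pi / s : ℝ) : ℂ))) ∂μ) =
        G 1 / Real.sin s - G' / s - G 0 / s := by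
      have : (∫ x, ∑' k : ℤ, -((-1) ^ k * ((a k : ℝ) : ℂ)) *
        (g x * Complex.exp (p x * Complex.I * ((k * Real.pi / s : ℝ) : ℂ))) ∂μ) =
          ∫ x, (g x * Complex.exp (p x * Complex.I * (1 : ℝ)) / Real.sin s
            - g x * (p x * Complex.I) / s - g x / s) ∂μ := by
        refine integral_congr_ae ?_
        filter_upwards [hps] with x hx
        by_cases h0 : g x = 0
        · simp [h0]
        have hx' : p x / s ∈ Set.Icc (-1 : ℝ) 1 := by
          have := abs_le.1 (hx h0)
          constructor
          · rw [le_div_iff₀ hs]; linarith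
          · rw [div_le_iff₀ hs]; linarith
        have h1 := ((hasSum_exp_mul_div_sin hs hs' hx').mul_left (g x)).tsum_eq
        have e1 : (s * Complex.I * ((p x / s : ℝ) : ℂ)) = p x * Complex.I * (1 : ℝ) := by
          push_cast; field_simp
        have e2 : (Complex.I * ((p x / s : ℝ) : ℂ)) = p x * Complex.I / s := by
          push_cast; ring
        rw [e1, e2] at h1
        have e3 : ∀ z : ℂ, g x * (z - p x * Complex.I / s - 1 / s) =
          g x * z - g x * (p x * Complex.I) / s - g x / s := fun z => by ring
        rw [e3, ← mul_div_assoc] at h1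
        rw [← h1]
        refine tsum_congr fun k => ?_
        have : (p x * Complex.I * ((k * Real.pi / s : ℝ) : ℂ)) =
          k * Real.pi * Complex.I * ((p x / s : ℝ) : ℂ) := by push_cast; ring
        rw [this]; ring
      rw [this, integral_sub, integral_sub, integral_div, integral_div, integral_div]
      · rw [hG0]
      · exact (hint 1).div_const _
      · exact hgp.div_const _
      · exact ((hint 1).div_const _).sub (hgp.div_const _)
      · exact hg.div_const _
    rw [hE] at h
    refine h.congr_fun fun k => ?_
    rw [integral_const_mul]
  have hsum' := Complex.hasSum_re (hsum.mul_left w)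
  have hval : (w * (G 1 / Real.sin s - G' / s - G 0 / s)).re =
      (w * G 1).re / Real.sin s - ‖G 0‖ ^ 2 / s := by
    have : w * (G 1 / Real.sin s - G' / s - G 0 / s) =
      (w * G 1) / Real.sin s - (w * G') / s - (w * G 0) / s := by ring
    rw [this, Complex.sub_re, Complex.sub_re, Complex.div_ofReal_re, Complex.div_ofReal_re,
      Complex.div_ofReal_re, hder0, hwG]
    ring
  rw [hval] at hsum'
  -- Each term has real part at least -a_k |G(0)|² because |G| ≤ |G(0)|. Summing gives Re(w
  -- G(1))/sin s - |G(0)|²/s ≥ -(1/s - cot s)|G(0)|², and the 1/s terms cancel.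
  have hlow := hasSum_le (fun k => ?_)
    (((hasSum_div_mul_int_mul_pi_sub hs hs').mul_right (‖G 0‖ ^ 2)).neg) hsum'
  · have h1 : Real.cos s / Real.sin s * ‖G 0‖ ^ 2 ≤ (w * G 1).re / Real.sin s := by
      have e : 1 / s * ‖G 0‖ ^ 2 = ‖G 0‖ ^ 2 / s := by ring
      nlinarith
    rw [div_mul_eq_mul_div, div_le_div_iff_of_pos_right hsin] at h1
    have h2 : (w * G 1).re ≤ ‖G 0‖ * ‖G 1‖ := by
      rw [← hwn, ← norm_mul]; exact Complex.re_le_norm _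
    rcases (norm_nonneg (G 0)).eq_or_lt with h3 | h3
    · rw [← h3]; simp
    · nlinarith
  · have h1 : ‖w * (-((-1) ^ k * ((a k : ℝ) : ℂ)) * G (k * Real.pi / s))‖ ≤ a k * ‖G 0‖ ^ 2 := by
      rw [norm_mul, norm_mul, norm_neg, norm_mul, norm_zpow, norm_neg, norm_one, one_zpow, one_mul,
            Complex.norm_real, Real.norm_of_nonneg (ha0 k), hwn]
      have := mul_le_mul_of_nonneg_left (hmax (k * Real.pi / s))
        (mul_nonneg (ha0 k) (norm_nonneg (G 0)))
      nlinarith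
    exact (abs_le.1 ((Complex.abs_re_le_norm _).trans h1)).1

/-! ### Plancherel's theorem for Fourier integrals of functions in L¹ ∩ L². -/

section Plancherel

variable {V : Type*} [NormedAddCommGroup V] [InnerProductSpace ℝ V] [FiniteDimensional ℝ V]
  [MeasurableSpace V] [BorelSpace V]

theorem continuous_fourier_of_integrable {f : V → ℂ} (hf : Integrable f) : Continuous (𝓕 f) :=
  VectorFourier.fourierIntegral_continuous Real.continuous_fourierChar
    (by exact continuous_inner) hf

/-- The Fourier integral of an integrable square-integrable function represents its
`L²`-Fourier transform. -/
theorem coeFn_fourier_toLp_ae_eq {f : V → ℂ} (h1 : Integrable f) (h2 : MemLp f 2) :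
    (𝓕 (h2.toLp f) : Lp ℂ 2 (volume : Measure V)) =ᵐ[volume] 𝓕 f := by
  -- Test against smooth compactly supported functions: the distributional definition on one side
  -- and the multiplication formula for Fourier integrals on the other both move the transform onto
  -- the test function.
  refine ae_eq_of_integral_contDiff_smul_eq ((Lp.memLp _).locallyIntegrable one_le_two)
    (continuous_fourier_of_integrable h1).locallyIntegrable fun g hg hgc => ?_
  have hg₁ : HasCompactSupport (Complex.ofRealCLM ∘ g) := hgc.comp_left rfl
  have hg₂ : ContDiff ℝ (⊤ : ℕ∞) (Complex.ofRealCLM ∘ g) := by fun_prop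
  set G : SchwartzMap V ℂ := hg₁.toSchwartzMap hg₂ with hG
  have hGg : ∀ x, G x = (g x : ℂ) := fun x => rfl
  have e1 := congrArg (fun T : TemperedDistribution V ℂ => T G)
    (Lp.fourier_toTemperedDistribution_eq (h2.toLp f))
  simp only [TemperedDistribution.fourier_apply, Lp.toTemperedDistribution_apply] at e1
  calc ∫ x, g x • (𝓕 (h2.toLp f) : Lp ℂ 2 (volume : Measure V)) x
      = ∫ x, G x • (𝓕 (h2.toLp f) : Lp ℂ 2 (volume : Measure V)) x := by simp [hGg]
    _ = ∫ x, (𝓕 G) x • (h2.toLp f) x := e1.symm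
    _ = ∫ x, (𝓕 (G : V → ℂ)) x • f x := by
        refine integral_congr_ae ?_
        filter_upwards [h2.coeFn_toLp] with x hx
        rw [hx, SchwartzMap.fourier_coe]
    _ = ∫ x, G x • 𝓕 f x := by
        have := VectorFourier.integral_fourierIntegral_smul_eq_flip (μ := (volume : Measure V))
          (ν := (volume : Measure V)) (L := innerₗ V) (f := (G : V → ℂ)) (g := f)
          Real.continuous_fourierChar (by exact continuous_inner) G.integrable h1
        rw [flip_innerₗ] at this
        exact this
    _ = ∫ x, g x • 𝓕 f x := by simp [hGg]

theorem memLp_fourier {f : V → ℂ} (h1 : Integrable f) (h2 : MemLp f 2) : MemLp (𝓕 f) 2 :=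
  (memLp_congr_ae (coeFn_fourier_toLp_ae_eq h1 h2)).1 (Lp.memLp _)

/-- **Plancherel's theorem** for inner products of integrable functions. -/
theorem integral_conj_fourier_mul_fourier {f g : V → ℂ} (hf1 : Integrable f) (hf2 : MemLp f 2)
    (hg1 : Integrable g) (hg2 : MemLp g 2) :
    ∫ ξ, 𝓕 g ξ * (starRingEnd ℂ) (𝓕 f ξ) = ∫ x, g x * (starRingEnd ℂ) (f x) := by
  have h := Lp.inner_fourier_eq (hf2.toLp f) (hg2.toLp g)
  rw [L2.inner_def, L2.inner_def] at h
  simp only [RCLike.inner_apply] at h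
  calc _ = _ := integral_congr_ae (by
        filter_upwards [coeFn_fourier_toLp_ae_eq hf1 hf2, coeFn_fourier_toLp_ae_eq hg1 hg2]
          with x hx hy
        rw [← hx, ← hy])
    _ = _ := h
    _ = _ := integral_congr_ae (by
        filter_upwards [hf2.coeFn_toLp, hg2.coeFn_toLp] with x hx hy
        rw [← hx, ← hy])

theorem lintegral_enorm_sq_eq_eLpNorm {X : Type*} [MeasurableSpace X] {μ : Measure X} (f : X → ℂ) :
    ∫⁻ x, ‖f x‖ₑ ^ 2 ∂μ = eLpNorm f 2 μ ^ 2 := by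
  have := eLpNorm_nnreal_pow_eq_lintegral (f := f) (μ := μ) (p := 2) two_ne_zero
  simpa using this.symm

/-- **Plancherel's theorem** for integrable functions. -/
theorem lintegral_enorm_sq_fourier {f : V → ℂ} (h1 : Integrable f) (h2 : MemLp f 2) :
    ∫⁻ ξ, ‖𝓕 f ξ‖ₑ ^ 2 = ∫⁻ x, ‖f x‖ₑ ^ 2 := by
  rw [lintegral_enorm_sq_eq_eLpNorm, lintegral_enorm_sq_eq_eLpNorm,
    ← eLpNorm_congr_ae (coeFn_fourier_toLp_ae_eq h1 h2), ← eLpNorm_congr_ae h2.coeFn_toLp,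
    ← Lp.enorm_def, ← Lp.enorm_def]
  have := Lp.norm_fourier_eq (h2.toLp f)
  rw [← enorm_eq_iff_norm_eq] at this
  rw [this]

end Plancherel

/-! ### Local behaviour of band-limited functions: decay near a maximum and local mean values. -/

section Band

variable {V : Type*} [NormedAddCommGroup V] [InnerProductSpace ℝ V] [FiniteDimensional ℝ V]
  [MeasurableSpace V] [BorelSpace V]

theorem norm_fourier_le_integral_norm (f : V → ℂ) (y : V) : ‖𝓕 f y‖ ≤ ∫ x, ‖f x‖ :=
  VectorFourier.norm_fourierIntegral_le_integral_norm _ _ _ f y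

theorem integrable_exp_inner_mul {f : V → ℂ} (hf : Integrable f) (y : V) :
    Integrable fun x => Complex.exp ((-2 * Real.pi * inner ℝ x y : ℝ) * Complex.I) * f x :=
  hf.bdd_mul (c := 1)
    (by fun_prop : Continuous fun x : V =>
      Complex.exp ((-2 * Real.pi * inner ℝ x y : ℝ) * Complex.I)).aestronglyMeasurable
    (Filter.Eventually.of_forall fun x => (Complex.norm_exp_ofReal_mul_I _).le)

/-- A product of a Fourier transform of a function supported where `⟪x, u⟫ ≤ q u` and a translate
of one supported where `⟪w, u⟫ ≤ ε * q u` decays at most like a cosine near its maximum. -/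
theorem exists_forall_cos_mul_norm_fourier_le {f φ : V → ℂ} (hf : Integrable f)
    (hφ : Integrable φ) {q : V → ℝ} {ε : ℝ}
    (hfq : ∀ᵐ x, f x ≠ 0 → ∀ u, |inner ℝ x u| ≤ q u)
    (hφq : ∀ w, φ w ≠ 0 → ∀ u, |inner ℝ w u| ≤ ε * q u) {s : ℝ} (hs : 0 < s)
    (hs' : s < Real.pi) (ξ : V) :
    ∃ z, ∀ y, 2 * Real.pi * ((1 + ε) * q (y - z)) ≤ s →
      Real.cos s * (‖𝓕 f ξ‖ * ‖𝓕 φ 0‖) ≤ ‖𝓕 f y‖ * ‖𝓕 φ (y - ξ)‖ := by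
  set G : V → ℂ := fun y => 𝓕 f y * 𝓕 φ (y - ξ) with hG
  by_cases h0 : ‖𝓕 f ξ‖ * ‖𝓕 φ 0‖ = 0
  · exact ⟨0, fun y _ => by rw [h0, mul_zero]; positivity⟩
  have hGξ : ‖G ξ‖ = ‖𝓕 f ξ‖ * ‖𝓕 φ 0‖ := by simp [hG]
  have hGc : Continuous G := (continuous_fourier_of_integrable hf).mul
    ((continuous_fourier_of_integrable hφ).comp (by fun_prop))
  have hG0 : Filter.Tendsto (fun y => ‖G y‖) (Filter.cocompact V) (nhds 0) := by
    have h1 : Filter.Tendsto (fun y => ‖𝓕 f y‖ * ∫ x, ‖φ x‖) (Filter.cocompact V) (nhds 0) := by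
      have h2 : Filter.Tendsto (𝓕 f) (Filter.cocompact V) (nhds 0) :=
        tendsto_integral_exp_inner_smul_cocompact f
      simpa using h2.norm.mul_const (∫ x, ‖φ x‖)
    refine squeeze_zero (fun y => norm_nonneg _) (fun y => ?_) h1
    rw [hG, norm_mul]
    exact mul_le_mul_of_nonneg_left (norm_fourier_le_integral_norm _ _) (norm_nonneg _)
  have hpos : 0 < ‖G ξ‖ := by
    rw [hGξ]; exact lt_of_le_of_ne (by positivity) (Ne.symm h0)
  -- A global maximum of |G| exists because G is continuous, tends to 0 at infinity by
  -- Riemann–Lebesgue, and is nonzero at ξ.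
  obtain ⟨z, hz⟩ := hGc.norm.exists_forall_ge' ξ
    ((hG0.eventually (gt_mem_nhds hpos)).mono fun y hy => hy.le)
  refine ⟨z, fun y hy => ?_⟩
  rw [← hGξ, ← norm_mul]
  set u := y - z with hu
  -- Along the line z + tu, the product of the two Fourier integrals is a single integral over V × V
  -- with phase t p. On the supports |p| ≤ 2π(1 + ε) q(u) ≤ s, so the one-dimensional inequality
  -- applies with maximum at t = 0.
  set g : V × V → ℂ := fun X =>
    (Complex.exp ((-2 * Real.pi * inner ℝ X.1 z : ℝ) * Complex.I) * f X.1) *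
    (Complex.exp ((-2 * Real.pi * inner ℝ X.2 (z - ξ) : ℝ) * Complex.I) * φ X.2) with hg
  set p : V × V → ℝ := fun X => -2 * Real.pi * inner ℝ (X.1 + X.2) u with hp
  have hgi : Integrable g (volume.prod volume) :=
    (integrable_exp_inner_mul hf z).mul_prod (integrable_exp_inner_mul hφ (z - ξ))
  have hgt : ∀ t : ℝ, ∫ X, g X * Complex.exp (p X * Complex.I * t) ∂(volume.prod volume) =
      G (z + t • u) := by
    intro t
    have h1 : ∀ X : V × V, g X * Complex.exp (p X * Complex.I * t) =
        (Complex.exp ((-2 * Real.pi * inner ℝ X.1 (z + t • u) : ℝ) * Complex.I) * f X.1) *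
        (Complex.exp ((-2 * Real.pi * inner ℝ X.2 (z + t • u - ξ) : ℝ) * Complex.I) * φ X.2) := by
      intro X
      have h2 : Complex.exp ((-2 * Real.pi * inner ℝ X.1 (z + t • u) : ℝ) * Complex.I) *
          Complex.exp ((-2 * Real.pi * inner ℝ X.2 (z + t • u - ξ) : ℝ) * Complex.I) =
          Complex.exp ((-2 * Real.pi * inner ℝ X.1 z : ℝ) * Complex.I) *
          Complex.exp ((-2 * Real.pi * inner ℝ X.2 (z - ξ) : ℝ) * Complex.I) *
          Complex.exp (p X * Complex.I * t) := by
        rw [← Complex.exp_add, ← Complex.exp_add, ← Complex.exp_add, hp]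
        congr 1
        simp only [inner_add_right, inner_add_left, inner_sub_right, inner_smul_right]
        push_cast
        ring
      rw [hg]
      linear_combination (-(f X.1 * φ X.2)) * h2
    simp_rw [h1]
    rw [integral_prod_mul (μ := (volume : Measure V)) (ν := (volume : Measure V))
      (fun x => Complex.exp ((-2 * Real.pi * inner ℝ x (z + t • u) : ℝ) * Complex.I) * f x)
      (fun x => Complex.exp ((-2 * Real.pi * inner ℝ x (z + t • u - ξ) : ℝ) * Complex.I) * φ x)]
    simp only [hG, Real.fourier_eq', smul_eq_mul]
  have hg0 : ∫ X, g X ∂(volume.prod volume) = G z := by simpa using hgt 0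
  have hg1 : ∫ X, g X * Complex.exp (p X * Complex.I) ∂(volume.prod volume) = G y := by
    simpa [hu] using hgt 1
  have hq := cos_mul_norm_integral_le_norm_integral_mul_exp hgi (p := p)
    (by fun_prop : Continuous p).measurable hs hs'
    (by
      have h3 : ∀ᵐ X : V × V ∂(volume.prod volume), f X.1 ≠ 0 → ∀ u, |inner ℝ X.1 u| ≤ q u :=
        Measure.quasiMeasurePreserving_fst.ae hfq
      filter_upwards [h3] with X hX hgX
      have hfX : f X.1 ≠ 0 := fun h => hgX (by simp [hg, h])
      have hφX : φ X.2 ≠ 0 := fun h => hgX (by simp [hg, h])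
      refine le_trans ?_ hy
      rw [hp]
      simp only [abs_mul, abs_neg, abs_two, abs_of_pos Real.pi_pos]
      refine mul_le_mul_of_nonneg_left ?_ (by positivity)
      rw [inner_add_left, add_mul, one_mul]
      exact (abs_add_le _ _).trans (add_le_add (hX hfX u) (hφq _ hφX u)))
    (fun t => by rw [hgt, hg0]; exact hz _)
  rw [hg0, hg1] at hq
  have hcos : Real.cos s * ‖G ξ‖ ≤ ‖G y‖ := by
    rcases le_or_gt 0 (Real.cos s) with hc | hc
    · exact (mul_le_mul_of_nonneg_left (hz ξ) hc).trans hq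
    · exact (mul_nonpos_of_nonpos_of_nonneg hc.le (norm_nonneg _)).trans (norm_nonneg _)
  exact hcos

theorem sq_lintegral_le_measure_mul_lintegral_sq {X : Type*} [MeasurableSpace X] {μ : Measure X}
    {f : X → ℂ} (hf : AEStronglyMeasurable f μ) :
    (∫⁻ x, ‖f x‖ₑ ∂μ) ^ 2 ≤ μ Set.univ * ∫⁻ x, ‖f x‖ₑ ^ 2 ∂μ := by
  have h := eLpNorm_le_eLpNorm_mul_rpow_measure_univ (p := 1) (q := 2) one_le_two hf
  rw [eLpNorm_one_eq_lintegral_enorm] at h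
  refine (pow_le_pow_left' h 2).trans ?_
  rw [lintegral_enorm_sq_eq_eLpNorm, mul_pow, mul_comm, ← ENNReal.rpow_natCast (μ Set.univ ^ _),
    ← ENNReal.rpow_mul]
  norm_num

/-- Local mean value bound for Fourier transforms of functions with bounded support. -/
theorem exists_enorm_sq_fourier_le_setLIntegral_ball {R : ℝ} (hR : 0 < R) :
    ∃ s > 0, ∃ C : ℝ≥0∞, C ≠ ∞ ∧ ∀ f : V → ℂ, Integrable f → MemLp f 2 →
      (∀ᵐ x, f x ≠ 0 → ‖x‖ ≤ R) → ∃ H : V → ℝ≥0∞, Measurable H ∧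
        ∫⁻ u, H u ≤ C * ∫⁻ x, ‖f x‖ₑ ^ 2 ∧
        ∀ y, ‖𝓕 f y‖ₑ ^ 2 ≤ ∫⁻ u in Metric.ball y s, H u := by
  -- For ‖t‖ < s and ‖x‖ ≤ R the phase 2π⟨t, x⟩ is at most π/3 in modulus, where the cosine is at
  -- least 1/2. Hence the transform k of the ball indicator is at least v/2 in modulus on the
  -- support of f.
  set s : ℝ := 1 / (6 * R) with hs
  have hs0 : 0 < s := by positivity
  set B : Set V := Metric.ball 0 s with hB
  set v : ℝ := volume.real B with hv
  have hBm : MeasurableSet B := measurableSet_ball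
  have hBfin : volume B < ∞ := measure_ball_lt_top
  have hv0 : 0 < v := ENNReal.toReal_pos (Metric.measure_ball_pos _ _ hs0).ne' hBfin.ne
  set k : V → ℂ := fun x => ∫ t in B, Complex.exp ((-2 * Real.pi * inner ℝ t x : ℝ) * Complex.I)
    with hk
  have hkF : k = 𝓕 (B.indicator (fun _ => (1 : ℂ))) := by
    ext x
    simp only [Real.fourier_eq', hk]
    rw [← integral_indicator hBm]
    congr 1
    ext t
    by_cases ht : t ∈ B <;> simp [ht]
  have hki : Integrable (B.indicator (fun _ => (1 : ℂ))) :=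
    (integrable_indicator_iff hBm).2 (integrableOn_const hBfin.ne)
  have hkc : Continuous k := by
    rw [hkF]; exact continuous_fourier_of_integrable hki
  have hklow : ∀ x : V, ‖x‖ ≤ R → v / 2 ≤ ‖k x‖ := by
    intro x hx
    have hint : IntegrableOn
        (fun t => Complex.exp ((-2 * Real.pi * inner ℝ t x : ℝ) * Complex.I)) B := by
      have := integrable_exp_inner_mul hki x
      rw [← integrable_indicator_iff hBm]
      refine this.congr (Filter.Eventually.of_forall fun t => ?_)
      by_cases ht : t ∈ B <;> simp [ht]
    have h1 : v / 2 ≤ (k x).re := by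
      rw [hk]
      have h2 : (∫ t in B, Complex.exp ((-2 * Real.pi * inner ℝ t x : ℝ) * Complex.I)).re =
        ∫ t in B, (Complex.exp ((-2 * Real.pi * inner ℝ t x : ℝ) * Complex.I)).re :=
        (integral_re hint).symm
      simp only
      rw [h2]
      have h3 : v / 2 = ∫ t in B, (1 / 2 : ℝ) := by
        rw [setIntegral_const, smul_eq_mul, hv]; ring
      rw [h3]
      refine setIntegral_mono_on (integrableOn_const hBfin.ne) hint.re hBm ?_
      intro t ht
      rw [Complex.exp_ofReal_mul_I_re]
      have h4 : |inner ℝ t x| ≤ 1 / 6 := by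
        refine (abs_real_inner_le_norm t x).trans ?_
        have h5 : ‖t‖ ≤ s := (mem_ball_zero_iff.1 ht).le
        calc ‖t‖ * ‖x‖ ≤ s * R := mul_le_mul h5 hx (norm_nonneg _) hs0.le
          _ = 1 / 6 := by rw [hs]; field_simp
      rw [← Real.cos_abs, ← Real.cos_pi_div_three]
      refine Real.cos_le_cos_of_nonneg_of_le_pi (abs_nonneg _) (by linarith [Real.pi_pos]) ?_
      rw [abs_mul, abs_mul, abs_neg, abs_two, abs_of_pos Real.pi_pos]
      nlinarith [Real.pi_pos]
    exact h1.trans (Complex.re_le_norm _)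
  refine ⟨s, hs0, volume B * ENNReal.ofReal (2 / v) ^ 2, by finiteness, ?_⟩
  intro f hf hf2 hfR
  -- Since f = g k and k is the transform of the indicator of B, f̂(y) is the integral of ĝ over the
  -- ball of radius s about y. Cauchy–Schwarz then gives the local bound, and ‖g‖₂ ≤ (2/v)‖f‖₂.
  set g : V → ℂ := fun x => f x / k x with hg
  have hgm : AEStronglyMeasurable g := by
    simp only [hg, div_eq_mul_inv]
    exact hf.1.mul hkc.measurable.inv.aestronglyMeasurable
  have hgf : ∀ᵐ x, ‖g x‖ ≤ ‖((2 / v : ℝ) : ℂ) * f x‖ := by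
    filter_upwards [hfR] with x hx
    by_cases h0 : f x = 0
    · simp [hg, h0]
    have := hklow x (hx h0)
    rw [hg, norm_div, norm_mul, Complex.norm_real, Real.norm_of_nonneg (by positivity),
      div_le_iff₀ (by linarith)]
    calc ‖f x‖ = 2 / v * ‖f x‖ * (v / 2) := by field_simp
      _ ≤ _ := mul_le_mul_of_nonneg_left this (by positivity)
  have hgi : Integrable g := (hf.const_mul _).mono hgm hgf
  have hg2 : MemLp g 2 := (hf2.const_mul _).of_le hgm hgf
  have hgc := continuous_fourier_of_integrable hgi
  have hgk : ∀ᵐ x, f x = g x * k x := by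
    filter_upwards [hfR] with x hx
    by_cases h0 : f x = 0
    · simp [hg, h0]
    have := hklow x (hx h0)
    have : k x ≠ 0 := norm_pos_iff.1 (by linarith)
    rw [hg]; field_simp
  refine ⟨fun u => volume B * ‖𝓕 g u‖ₑ ^ 2, by fun_prop, ?_, ?_⟩
  · rw [lintegral_const_mul _ (by fun_prop), lintegral_enorm_sq_fourier hgi hg2, mul_assoc]
    gcongr
    rw [← lintegral_const_mul' _ _ (by finiteness)]
    refine lintegral_mono_ae ?_
    filter_upwards [hgf] with x hx
    rw [← mul_pow]
    gcongr
    rw [norm_mul, Complex.norm_real, Real.norm_of_nonneg (by positivity)] at hx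
    rw [← ofReal_norm, ← ofReal_norm, ← ENNReal.ofReal_mul (by positivity)]
    exact ENNReal.ofReal_le_ofReal hx
  · intro y
    have h1 : 𝓕 f y = ∫ t in B, 𝓕 g (y + t) := by
      simp only [Real.fourier_eq', smul_eq_mul]
      rw [integral_integral_swap]
      · refine integral_congr_ae ?_
        filter_upwards [hgk] with x hx
        rw [hx, hk, mul_comm (g x), ← mul_assoc, ← integral_const_mul, ← integral_mul_const]
        congr 1
        ext t
        rw [← Complex.exp_add]
        congr 2
        rw [inner_add_right, real_inner_comm t x]
        push_cast
        ring
      · have h2 : Integrable (fun X : V × V => (1 : ℂ) * g X.2)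
            ((volume.restrict B).prod volume) :=
          (integrableOn_const (C := (1 : ℂ)) hBfin.ne).mul_prod hgi
        have h3 := h2.bdd_mul (c := 1) (f := fun X : V × V =>
            Complex.exp ((-2 * Real.pi * inner ℝ X.2 (y + X.1) : ℝ) * Complex.I))
          (by fun_prop : Continuous fun X : V × V =>
            Complex.exp ((-2 * Real.pi * inner ℝ X.2 (y + X.1) : ℝ) * Complex.I)).aestronglyMeasurable
          (Filter.Eventually.of_forall fun x => (Complex.norm_exp_ofReal_mul_I _).le)
        simpa [Function.uncurry_def] using h3
    have h4 : ‖𝓕 f y‖ₑ ^ 2 ≤ volume B * ∫⁻ t in B, ‖𝓕 g (y + t)‖ₑ ^ 2 := by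
      rw [h1]
      refine (pow_le_pow_left' (enorm_integral_le_lintegral_enorm _) 2).trans ?_
      have := sq_lintegral_le_measure_mul_lintegral_sq (μ := volume.restrict B)
        (f := fun t => 𝓕 g (y + t)) (hgc.comp (by fun_prop)).aestronglyMeasurable
      rwa [Measure.restrict_apply_univ] at this
    refine h4.trans (le_of_eq ?_)
    rw [lintegral_const_mul _ (by fun_prop)]
    congr 1
    rw [← lintegral_indicator hBm, ← lintegral_indicator measurableSet_ball,
      ← lintegral_add_left_eq_self ((Metric.ball y s).indicator fun u => ‖𝓕 g u‖ₑ ^ 2) y]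
    congr 1
    ext t
    by_cases ht : t ∈ B
    · rw [Set.indicator_of_mem ht, Set.indicator_of_mem]
      simpa [hB] using ht
    · rw [Set.indicator_of_notMem ht, Set.indicator_of_notMem]
      simpa [hB] using ht

end Band

/-! ### Upper and lower bounds for weighted sums of samples. -/

section Tail

variable {V : Type*} [NormedAddCommGroup V] [InnerProductSpace ℝ V] [FiniteDimensional ℝ V]
  [MeasurableSpace V] [BorelSpace V]

theorem exists_setLIntegral_norm_gt_le {h : V → ℝ≥0∞} (hh : Measurable h) (hfin : ∫⁻ u, h u ≠ ∞)
    {δ : ℝ≥0∞} (hδ : 0 < δ) : ∃ M : ℕ, ∫⁻ u in {u : V | (M : ℝ) < ‖u‖}, h u ≤ δ := by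
  have hm : ∀ M : ℕ, MeasurableSet {u : V | (M : ℝ) < ‖u‖} := fun M =>
    measurableSet_lt measurable_const measurable_norm
  have h1 : Filter.Tendsto (fun M : ℕ => ∫⁻ u, {u : V | (M : ℝ) < ‖u‖}.indicator h u)
      Filter.atTop (nhds (∫⁻ _ : V, 0)) := by
    refine tendsto_lintegral_of_dominated_convergence h (fun M => hh.indicator (hm M))
      (fun M => Filter.Eventually.of_forall fun u => Set.indicator_le_self _ _ _) hfin
      (Filter.Eventually.of_forall fun u => ?_)
    obtain ⟨N, hN⟩ := exists_nat_ge ‖u‖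
    refine tendsto_const_nhds.congr' ?_
    filter_upwards [Filter.eventually_ge_atTop N] with M hM
    rw [Set.indicator_of_notMem]
    have : (N : ℝ) ≤ M := by exact_mod_cast hM
    simp only [Set.mem_ofPred_eq, not_lt]
    linarith
  rw [lintegral_zero] at h1
  obtain ⟨M, hM⟩ := (h1.eventually (gt_mem_nhds hδ)).exists
  refine ⟨M, ?_⟩
  rw [← lintegral_indicator (hm M)]
  exact hM.le

variable {ι : Type*} [Countable ι]

/-- Upper bound for weighted sums of samples of the Fourier transform. -/
theorem exists_tsum_measure_mul_enorm_sq_fourier_le {R r : ℝ} (hR : 0 < R) :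
    ∃ C : ℝ≥0∞, C ≠ ∞ ∧ ∀ (e : ι → V) (W : ι → Set V), (∀ i, MeasurableSet (W i)) →
      Pairwise (Function.onFun Disjoint W) → (∀ i, ∀ z ∈ W i, ‖e i - z‖ ≤ r) →
      ∀ f : V → ℂ, Integrable f → MemLp f 2 → (∀ᵐ x, f x ≠ 0 → ‖x‖ ≤ R) →
      ∑' i, volume (W i) * ‖𝓕 f (e i)‖ₑ ^ 2 ≤ C * ∫⁻ x, ‖f x‖ₑ ^ 2 := by
  obtain ⟨s, hs, C, hC, h⟩ := exists_enorm_sq_fourier_le_setLIntegral_ball (V := V) hR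
  refine ⟨volume (Metric.ball (0 : V) (s + r)) * C, by
    have := (measure_ball_lt_top (μ := volume) (x := (0 : V)) (r := s + r)).ne
    finiteness, ?_⟩
  intro e W hWm hWd hWe f hf hf2 hfR
  obtain ⟨H, hHm, hH, hHF⟩ := h f hf hf2 hfR
  have hset : MeasurableSet {X : V × V | dist X.2 X.1 < s + r} :=
    measurableSet_lt (by fun_prop) measurable_const
  -- For z in the cell of e_i, the ball of radius s about e_i lies in the ball of radius s + r about
  -- z. Replacing the former by the latter turns the weighted sum into a double integral over
  -- disjoint cells. The kernel is written as an indicator on the product so that it is jointly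
  -- measurable and Tonelli applies.
  set k : V → V → ℝ≥0∞ := fun z u => {X : V × V | dist X.2 X.1 < s + r}.indicator
    (fun X => H X.2) (z, u) with hk
  have hkm : Measurable (Function.uncurry k) := (hHm.comp measurable_snd).indicator hset
  have h1 : ∀ z u, k z u = (Metric.ball z (s + r)).indicator H u := fun z u => by
    by_cases hu : dist u z < s + r
    · rw [hk, Set.indicator_of_mem (by exact hu)]
      simp only
      rw [Set.indicator_of_mem (by exact hu)]
    · rw [hk, Set.indicator_of_notMem (by exact hu)]
      simp only
      rw [Set.indicator_of_notMem (by exact hu)]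
  have h1' : ∀ z u, k z u = (Metric.ball u (s + r)).indicator (fun _ => H u) z := fun z u => by
    rw [h1]
    by_cases hu : dist u z < s + r
    · rw [Set.indicator_of_mem (by exact hu), Set.indicator_of_mem (by exact Metric.mem_ball'.2 hu)]
    · rw [Set.indicator_of_notMem (by exact hu),
        Set.indicator_of_notMem (by exact fun h => hu (Metric.mem_ball'.1 h))]
  calc ∑' i, volume (W i) * ‖𝓕 f (e i)‖ₑ ^ 2
      ≤ ∑' i, ∫⁻ z in W i, ∫⁻ u, k z u := by
        refine ENNReal.tsum_le_tsum fun i => ?_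
        rw [mul_comm, ← setLIntegral_const]
        refine setLIntegral_mono' (hWm i) fun z hz => ?_
        simp_rw [h1]
        rw [lintegral_indicator measurableSet_ball]
        refine (hHF (e i)).trans (lintegral_mono_set ?_)
        refine Metric.ball_subset_ball' ?_
        rw [dist_eq_norm]
        linarith [hWe i z hz]
    _ = ∫⁻ z in ⋃ i, W i, ∫⁻ u, k z u := (lintegral_iUnion hWm hWd _).symm
    _ ≤ ∫⁻ z, ∫⁻ u, k z u := setLIntegral_le_lintegral _ _
    _ = ∫⁻ u, ∫⁻ z, k z u := lintegral_lintegral_swap hkm.aemeasurable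
    _ = ∫⁻ u, volume (Metric.ball (0 : V) (s + r)) * H u := by
        refine lintegral_congr fun u => ?_
        simp_rw [h1']
        rw [lintegral_indicator_const measurableSet_ball, mul_comm,
          Measure.addHaar_ball_center]
    _ = volume (Metric.ball (0 : V) (s + r)) * ∫⁻ u, H u := lintegral_const_mul _ hHm
    _ ≤ volume (Metric.ball (0 : V) (s + r)) * C * ∫⁻ x, ‖f x‖ₑ ^ 2 := by
        rw [mul_assoc]; gcongr

/-- Lower bound for weighted sums of samples of the Fourier transform, localized by `𝓕 φ`. -/
theorem measure_mul_enorm_sq_fourier_le_tsum {f φ : V → ℂ} (hf : Integrable f)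
    (hφ : Integrable φ) (hφ1 : 𝓕 φ 0 = 1) {q : V → ℝ} {ε : ℝ}
    (hfq : ∀ᵐ x, f x ≠ 0 → ∀ u, |inner ℝ x u| ≤ q u)
    (hφq : ∀ w, φ w ≠ 0 → ∀ u, |inner ℝ w u| ≤ ε * q u) {s : ℝ} (hs : 0 < s)
    (hs' : s < Real.pi) (hε : 0 ≤ ε) (hqadd : ∀ u v, q (u + v) ≤ q u + q v)
    {ρ η : ℝ} (hρη : 2 * Real.pi * ((1 + ε) * (ρ + η)) ≤ s)
    {e : ι → V} {W : ι → Set V} (hWc : ⋃ i, W i = Set.univ) (hWe : ∀ i, ∀ z ∈ W i, q (e i - z) ≤ ρ)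
    (ξ : V) :
    volume {u | q u < η} * (ENNReal.ofReal (Real.cos s) ^ 2 * ‖𝓕 f ξ‖ₑ ^ 2) ≤
      ∑' i, volume (W i) * (‖𝓕 f (e i)‖ₑ ^ 2 * ‖𝓕 φ (e i - ξ)‖ₑ ^ 2) := by
  obtain ⟨z, hz⟩ := exists_forall_cos_mul_norm_fourier_le hf hφ hfq hφq hs hs' ξ
  set B : Set V := {u | q u < η} with hB
  have hBz : volume ((fun u => u + -z) ⁻¹' B) = volume B := measure_preimage_add_right _ _ _
  -- The cells cover the q-ball of radius η about z. A cell meeting it has its sample point within ρ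
  -- + η of z, where the cosine bound holds; all other cells contribute 0 to this sum.
  have h1 : volume B ≤ ∑' i, volume (W i ∩ (fun u => u + -z) ⁻¹' B) := by
    rw [← hBz]
    refine le_trans (le_of_eq ?_) (measure_iUnion_le _)
    rw [← Set.iUnion_inter, hWc, Set.univ_inter]
  refine (mul_le_mul_left h1 _).trans ?_
  rw [← ENNReal.tsum_mul_right]
  refine ENNReal.tsum_le_tsum fun i => ?_
  rcases (W i ∩ (fun u => u + -z) ⁻¹' B).eq_empty_or_nonempty with h2 | ⟨y, hy, hyB⟩
  · rw [h2]; simp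
  · refine mul_le_mul' (measure_mono Set.inter_subset_left) ?_
    have h3 : q (e i - z) ≤ ρ + η := by
      have : e i - z = (e i - y) + (y + -z) := by abel
      rw [this]
      refine (hqadd _ _).trans (add_le_add (hWe i y hy) (le_of_lt hyB))
    have h4 := hz (e i) (le_trans (by
      have := Real.pi_pos
      gcongr) hρη)
    rw [hφ1, norm_one, mul_one] at h4
    rw [← mul_pow, ← mul_pow]
    refine pow_le_pow_left' ?_ 2
    rw [← ofReal_norm, ← ofReal_norm, ← ofReal_norm, ← ENNReal.ofReal_mul (norm_nonneg _)]
    rcases le_or_gt 0 (Real.cos s) with hc | hc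
    · rw [← ENNReal.ofReal_mul hc]; exact ENNReal.ofReal_le_ofReal h4
    · rw [ENNReal.ofReal_of_nonpos hc.le, zero_mul]; exact bot_le

/-- Integrated form: the high-frequency part of the Fourier transform is bounded by the
high-frequency samples and a localization error. -/
theorem measure_mul_setLIntegral_enorm_sq_fourier_le {f φ : V → ℂ} (hf : Integrable f)
    (hφ : Integrable φ) (hφ1 : 𝓕 φ 0 = 1) {q : V → ℝ} {ε : ℝ}
    (hfq : ∀ᵐ x, f x ≠ 0 → ∀ u, |inner ℝ x u| ≤ q u)
    (hφq : ∀ w, φ w ≠ 0 → ∀ u, |inner ℝ w u| ≤ ε * q u) {s : ℝ} (hs : 0 < s)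
    (hs' : s < Real.pi) (hε : 0 ≤ ε) (hqadd : ∀ u v, q (u + v) ≤ q u + q v)
    {ρ η : ℝ} (hρη : 2 * Real.pi * ((1 + ε) * (ρ + η)) ≤ s)
    {e : ι → V} {W : ι → Set V} (hWc : ⋃ i, W i = Set.univ) (hWe : ∀ i, ∀ z ∈ W i, q (e i - z) ≤ ρ)
    (K M : ℝ) :
    volume {u | q u < η} * (ENNReal.ofReal (Real.cos s) ^ 2 *
      ∫⁻ ξ in {ξ : V | K + M < ‖ξ‖}, ‖𝓕 f ξ‖ₑ ^ 2) ≤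
      (∑' i, volume (W i) * ‖𝓕 f (e i)‖ₑ ^ 2) * (∫⁻ u in {u : V | M < ‖u‖}, ‖𝓕 φ u‖ₑ ^ 2) +
      (∑' i, {i | K < ‖e i‖}.indicator (fun i => volume (W i) * ‖𝓕 f (e i)‖ₑ ^ 2) i) *
        ∫⁻ u, ‖𝓕 φ u‖ₑ ^ 2 := by
  have hfc := continuous_fourier_of_integrable hf
  have hφc := continuous_fourier_of_integrable hφ
  set T : Set V := {ξ : V | K + M < ‖ξ‖} with hT
  have hTm : MeasurableSet T := measurableSet_lt measurable_const measurable_norm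
  rw [← lintegral_const_mul _ (by fun_prop), ← lintegral_const_mul _ (by fun_prop)]
  have hφm : ∀ i, Measurable fun ξ => ‖𝓕 φ (e i - ξ)‖ₑ ^ 2 := fun i =>
    ((hφc.comp (continuous_const.sub continuous_id)).enorm.measurable).pow_const 2
  refine (lintegral_mono fun ξ => measure_mul_enorm_sq_fourier_le_tsum hf hφ hφ1 hfq hφq hs hs' hε
    hqadd hρη hWc hWe ξ).trans ?_
  rw [lintegral_tsum fun i => (((hφm i).const_mul _).const_mul _).aemeasurable, ← ENNReal.tsum_mul_right, ← ENNReal.tsum_mul_right,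
    ← ENNReal.tsum_add]
  refine ENNReal.tsum_le_tsum fun i => ?_
  rw [lintegral_const_mul _ ((hφm i).const_mul _), lintegral_const_mul _ (hφm i), ← mul_assoc]
  -- If ‖e i‖ ≤ K, then ‖ξ‖ > K + M forces ‖e i - ξ‖ > M, so only the tail of φ̂ enters. Otherwise
  -- the whole integral of |φ̂|² is allowed.
  by_cases hi : K < ‖e i‖
  · rw [Set.indicator_of_mem (by exact hi)]
    refine le_add_left (mul_le_mul' le_rfl ?_)
    refine (setLIntegral_le_lintegral _ _).trans ?_
    rw [lintegral_sub_left_eq_self (fun u => ‖𝓕 φ u‖ₑ ^ 2) (e i)]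
  · refine le_add_right (mul_le_mul' le_rfl ?_)
    rw [← lintegral_indicator hTm, ← lintegral_indicator
      (measurableSet_lt measurable_const measurable_norm),
      ← lintegral_sub_left_eq_self ({u : V | M < ‖u‖}.indicator fun u => ‖𝓕 φ u‖ₑ ^ 2) (e i)]
    refine lintegral_mono fun ξ => ?_
    by_cases hξ : ξ ∈ T
    · rw [Set.indicator_of_mem hξ, Set.indicator_of_mem]
      have h1 : K + M < ‖ξ‖ := hξ
      have h2 := norm_sub_norm_le ξ (e i)
      rw [norm_sub_rev] at h2
      simp only [Set.mem_ofPred_eq]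
      linarith [not_lt.1 hi]
    · rw [Set.indicator_of_notMem hξ]; exact bot_le

end Tail

/-! ### The polar norm and Voronoi cells. -/

section Polar

variable {d : ℕ} {D : Set (EuclideanSpace ℝ (Fin d))}

theorem convex_polarSet (D : Set (EuclideanSpace ℝ (Fin d))) : Convex ℝ (polarSet D) := by
  intro a ha b hb s t hs ht hst x hx
  rw [inner_add_right, inner_smul_right, inner_smul_right]
  nlinarith [ha x hx, hb x hx]

theorem IsCenteredSymmetricConvexBody.exists_norm_le (hD : IsCenteredSymmetricConvexBody D) :
    ∃ R > 0, ∀ x ∈ D, ‖x‖ ≤ R := by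
  obtain ⟨R, hR, h⟩ := hD.isCompact.isBounded.exists_pos_norm_le
  exact ⟨R, hR, h⟩

theorem polarSet_mem_nhds_zero (hD : IsCenteredSymmetricConvexBody D) : polarSet D ∈ nhds 0 := by
  obtain ⟨R, hR, h⟩ := hD.exists_norm_le
  refine Filter.mem_of_superset (Metric.ball_mem_nhds 0 (inv_pos.2 hR)) fun z hz x hx => ?_
  refine (real_inner_le_norm x z).trans ?_
  have hz' : ‖z‖ ≤ R⁻¹ := (mem_ball_zero_iff.1 hz).le
  calc ‖x‖ * ‖z‖ ≤ R * R⁻¹ := mul_le_mul (h x hx) hz' (norm_nonneg _) hR.le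
    _ = 1 := mul_inv_cancel₀ hR.ne'

/-- Pair x with an almost optimal representation of u as a multiple of a polar point; symmetry of D
gives the absolute value. This is how support in D becomes a bound on exponential type in direction
u. -/
theorem abs_inner_le_gauge_polarSet (hD : IsCenteredSymmetricConvexBody D)
    {x : EuclideanSpace ℝ (Fin d)} (hx : x ∈ D) (u : EuclideanSpace ℝ (Fin d)) :
    |inner ℝ x u| ≤ gauge (polarSet D) u := by
  refine le_of_forall_pos_le_add fun δ hδ => ?_
  obtain ⟨b, hb0, hb, w, hw, rfl⟩ := exists_lt_of_gauge_lt
    (absorbent_nhds_zero (polarSet_mem_nhds_zero hD)) (lt_add_of_pos_right (gauge (polarSet D) u) hδ)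
  refine le_trans ?_ hb.le
  have h1 := hw x hx
  have h2 := hw (-x) (hD.neg_mem x hx)
  simp only [inner_smul_right, inner_neg_left] at h1 h2 ⊢
  rw [abs_le]
  constructor <;> nlinarith

/-- D contains a multiple of u of fixed positive length, and pairing u with it bounds the gauge from
below. The estimate gives existence of nearest points and converts polar bounds into Euclidean ones.
-/
theorem exists_mul_norm_le_gauge_polarSet (hD : IsCenteredSymmetricConvexBody D) :
    ∃ c > 0, ∀ u, c * ‖u‖ ≤ gauge (polarSet D) u := by
  obtain ⟨c, hc, h⟩ := Metric.mem_nhds_iff.1 (mem_interior_iff_mem_nhds.1 hD.zero_mem_interior)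
  refine ⟨c / 2, by positivity, fun u => ?_⟩
  rcases eq_or_ne u 0 with rfl | hu
  · simp
  have hu' : 0 < ‖u‖ := norm_pos_iff.2 hu
  have hx : (c / 2 / ‖u‖) • u ∈ D := by
    apply h
    rw [mem_ball_zero_iff, norm_smul, Real.norm_of_nonneg (by positivity),
      div_mul_cancel₀ _ hu'.ne']
    linarith
  have := (le_abs_self _).trans (abs_inner_le_gauge_polarSet hD hx u)
  rwa [inner_smul_left, real_inner_self_eq_norm_sq, RCLike.conj_to_real,
    show c / 2 / ‖u‖ * ‖u‖ ^ 2 = c / 2 * ‖u‖ by field_simp] at this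

theorem continuous_gauge_polarSet (hD : IsCenteredSymmetricConvexBody D) :
    Continuous (gauge (polarSet D)) :=
  continuous_gauge (convex_polarSet D) (polarSet_mem_nhds_zero hD)

/-- A closed set contains a nearest point for the norm induced by the polar set. -/
theorem exists_forall_gauge_polarSet_le (hD : IsCenteredSymmetricConvexBody D)
    {Ω : Set (EuclideanSpace ℝ (Fin d))} (hΩ : IsClosed Ω) (hne : Ω.Nonempty)
    (z : EuclideanSpace ℝ (Fin d)) :
    ∃ ω ∈ Ω, ∀ l ∈ Ω, gauge (polarSet D) (ω - z) ≤ gauge (polarSet D) (l - z) := by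
  obtain ⟨ω₀, hω₀⟩ := hne
  obtain ⟨c, hc, hcn⟩ := exists_mul_norm_le_gauge_polarSet hD
  have h1 : Filter.Tendsto (fun l => c * (‖l‖ - ‖z‖))
      (Filter.cocompact (EuclideanSpace ℝ (Fin d))) Filter.atTop :=
    (Filter.tendsto_atTop_add_const_right _ _ tendsto_norm_cocompact_atTop).const_mul_atTop hc
  have hcont : Continuous fun l => gauge (polarSet D) (l - z) :=
    (continuous_gauge_polarSet hD).comp (by fun_prop)
  obtain ⟨ω, hω, h⟩ := hcont.continuousOn.exists_isMinOn' hΩ hω₀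
    (Filter.Eventually.filter_mono inf_le_left
      ((h1.eventually_ge_atTop (gauge (polarSet D) (ω₀ - z))).mono fun l hl => by
        refine hl.trans (le_trans ?_ (hcn (l - z)))
        exact mul_le_mul_of_nonneg_left (norm_sub_norm_le _ _) hc.le))
  exact ⟨ω, hω, fun l hl => h hl⟩

theorem isClosed_voronoiRegion (hD : IsCenteredSymmetricConvexBody D)
    (Ω : Set (EuclideanSpace ℝ (Fin d))) (ω : EuclideanSpace ℝ (Fin d)) :
    IsClosed (voronoiRegion (polarSet D) Ω ω) := by
  have h : voronoiRegion (polarSet D) Ω ω = ⋂ l ∈ Ω, ⋂ _ : l ≠ ω,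
      {z | gauge (polarSet D) (ω - z) ≤ gauge (polarSet D) (l - z)} := by
    ext z; simp [voronoiRegion]
  rw [h]
  have hg := continuous_gauge_polarSet hD
  exact isClosed_biInter fun l _ => isClosed_iInter fun _ =>
    isClosed_le (hg.comp (by fun_prop)) (hg.comp (by fun_prop))

/-- For z in the Voronoi region of ω, the infimum in the gap at z is attained at ω. -/
theorem gauge_polarSet_le_toReal_gap {Ω : Set (EuclideanSpace ℝ (Fin d))}
    (hgap : gap (polarSet D) Ω ≠ ∞) {ω : EuclideanSpace ℝ (Fin d)} (hω : ω ∈ Ω)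
    {z : EuclideanSpace ℝ (Fin d)} (hz : z ∈ voronoiRegion (polarSet D) Ω ω) :
    gauge (polarSet D) (ω - z) ≤ (gap (polarSet D) Ω).toReal := by
  rw [← ENNReal.ofReal_le_iff_le_toReal hgap]
  refine le_trans ?_ (le_iSup (fun z => ⨅ ω ∈ Ω, ENNReal.ofReal (gauge (polarSet D) (ω - z))) z)
  refine le_iInf₂ fun l hl => ENNReal.ofReal_le_ofReal ?_
  rcases eq_or_ne l ω with rfl | h
  · exact le_rfl
  · exact hz l hl h

/-- Disjoint measurable cells inside the Voronoi regions that still cover the space. -/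
theorem exists_disjoint_voronoi_cells (hD : IsCenteredSymmetricConvexBody D)
    {Ω : Set (EuclideanSpace ℝ (Fin d))} (hΩ : IsClosed Ω) (hc : Ω.Countable) (hne : Ω.Nonempty) :
    ∃ W : Ω → Set (EuclideanSpace ℝ (Fin d)), (∀ i, MeasurableSet (W i)) ∧
      Pairwise (Function.onFun Disjoint W) ∧ ⋃ i, W i = Set.univ ∧
      ∀ i, W i ⊆ voronoiRegion (polarSet D) Ω i := by
  have : Countable Ω := hc.to_subtype
  obtain ⟨n, hn⟩ := exists_injective_nat Ω
  set v : Ω → Set (EuclideanSpace ℝ (Fin d)) := fun i => voronoiRegion (polarSet D) Ω i with hv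
  have hvm : ∀ i, MeasurableSet (v i) := fun i => (isClosed_voronoiRegion hD Ω i).measurableSet
  -- Each point goes to the first region, in an enumeration of Ω, that contains it. Disjointness has
  -- to be arranged, since for a norm that is not strictly convex Voronoi regions can overlap in
  -- positive measure.
  refine ⟨fun i => v i \ ⋃ j, ⋃ _ : n j < n i, v j, fun i => (hvm i).diff
    (MeasurableSet.iUnion fun j => MeasurableSet.iUnion fun _ => hvm j), ?_, ?_,
    fun i => Set.sdiff_subset⟩
  · have key : ∀ i j, n i < n j → Disjoint (v i \ ⋃ k, ⋃ _ : n k < n i, v k)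
        (v j \ ⋃ k, ⋃ _ : n k < n j, v k) := fun i j hij => by
      rw [Set.disjoint_left]
      rintro z ⟨hz, -⟩ ⟨-, hz'⟩
      exact hz' (Set.mem_iUnion₂.2 ⟨i, hij, hz⟩)
    intro i j hij
    rcases lt_or_gt_of_ne (hn.ne hij) with h | h
    · exact key i j h
    · exact (key j i h).symm
  · refine Set.eq_univ_of_forall fun z => ?_
    have hex : ∃ m, ∃ i, n i = m ∧ z ∈ v i := by
      obtain ⟨ω, hω, h⟩ := exists_forall_gauge_polarSet_le hD hΩ hne z
      exact ⟨_, ⟨ω, hω⟩, rfl, fun l hl _ => h l hl⟩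
    classical
    obtain ⟨i, hi, hzi⟩ := Nat.find_spec hex
    refine Set.mem_iUnion.2 ⟨i, hzi, fun hz => ?_⟩
    obtain ⟨j, hj, hzj⟩ := Set.mem_iUnion₂.1 hz
    rw [hi] at hj
    exact Nat.find_min hex hj ⟨j, rfl, hzj⟩

end Polar

/-! ### Elements of L²(D) as integrable functions. -/

section L2On

variable {d : ℕ} {D : Set (EuclideanSpace ℝ (Fin d))}

theorem integrable_of_mem_L2On (hD : IsCompact D)
    {f : Lp ℂ 2 (volume : Measure (EuclideanSpace ℝ (Fin d)))} (hf : f ∈ L2On D) :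
    Integrable f := by
  have h1 : IntegrableOn f D := by
    have : IsFiniteMeasure ((volume : Measure (EuclideanSpace ℝ (Fin d))).restrict D) :=
      ⟨by rw [Measure.restrict_apply_univ]; exact hD.measure_lt_top⟩
    exact ((Lp.memLp f).restrict D).integrable one_le_two
  exact h1.integrable_of_ae_notMem_eq_zero hf

theorem lintegral_enorm_sq_coeFn (f : Lp ℂ 2 (volume : Measure (EuclideanSpace ℝ (Fin d)))) :
    ∫⁻ x, ‖f x‖ₑ ^ 2 = ‖f‖ₑ ^ 2 := by
  rw [lintegral_enorm_sq_eq_eLpNorm, ← Lp.enorm_def]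

theorem lintegral_enorm_sq_coeFn_of_norm_eq_one
    {f : Lp ℂ 2 (volume : Measure (EuclideanSpace ℝ (Fin d)))} (hf : ‖f‖ = 1) :
    ∫⁻ x, ‖f x‖ₑ ^ 2 = 1 := by
  rw [lintegral_enorm_sq_coeFn, ← ofReal_norm, hf]; simp

end L2On

/-! ### Part (a): comparison of residuals when the gap is below 1/4. -/

section Residual

variable {d : ℕ} {D : Set (EuclideanSpace ℝ (Fin d))}

/-- If the gap of `Ω` is less than `1 / 4`, the intrinsic residual is controlled by the sampling
residual at a frequency smaller by an additive constant. -/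
theorem exists_intrinsicResidual_le (hD : IsCenteredSymmetricConvexBody D)
    {Ω : Set (EuclideanSpace ℝ (Fin d))} (hΩ : IsClosed Ω) (hc : Ω.Countable)
    (hgap : gap (polarSet D) Ω < 1 / 4) :
    ∃ C : ℝ≥0∞, C ≠ ∞ ∧ ∀ δ : ℝ≥0∞, 0 < δ → ∃ M : ℝ, 0 ≤ M ∧
      ∀ R : Submodule ℂ (Lp ℂ 2 (volume : Measure (EuclideanSpace ℝ (Fin d)))), R ≤ L2On D →
      ∀ K : ℝ, intrinsicResidual R (K + M) ≤ C * (δ + samplingResidual D R Ω K) := by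
  have hgap' : gap (polarSet D) Ω ≠ ∞ := (hgap.trans_le le_top).ne
  have hne : Ω.Nonempty := by
    by_contra h
    rw [Set.not_nonempty_iff_eq_empty] at h
    exact hgap' (by simp [gap, h])
  set q := gauge (polarSet D) with hq
  have hqc : Continuous q := continuous_gauge_polarSet hD
  obtain ⟨c, hc0, hcq⟩ := exists_mul_norm_le_gauge_polarSet hD
  obtain ⟨R₀, hR₀, hDR⟩ := hD.exists_norm_le
  set ρ := (gap (polarSet D) Ω).toReal with hρ
  have hρ0 : 0 ≤ ρ := ENNReal.toReal_nonneg
  have hρ4 : ρ < 1 / 4 := by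
    have := (ENNReal.toReal_lt_toReal hgap' (by simp)).2 hgap
    simpa using this
  -- The slack is shared between the enlargement of the support by φ and the radius of the ball
  -- around the maximum. Since ρ + η ≤ 1, (1 + η)(ρ + η) ≤ ρ + 2η < 1/4, which gives s < π/2.
  set η := (1 / 4 - ρ) / 4 with hη
  have hη0 : 0 < η := by rw [hη]; linarith
  set s := 2 * Real.pi * (ρ + 2 * η) with hs
  have hpi := Real.pi_pos
  have hs0 : 0 < s := by positivity
  have hs2 : s < Real.pi / 2 := by
    rw [hs, hη]; nlinarith
  have hcos : 0 < Real.cos s := Real.cos_pos_of_mem_Ioo ⟨by linarith, hs2⟩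
  have hρη : 2 * Real.pi * ((1 + η) * (ρ + η)) ≤ s := by
    rw [hs]
    refine mul_le_mul_of_nonneg_left ?_ (by positivity)
    have : ρ + η ≤ 1 := by rw [hη]; linarith
    nlinarith
  set B : Set (EuclideanSpace ℝ (Fin d)) := Metric.ball 0 (η * c) with hB
  have hBm : MeasurableSet B := measurableSet_ball
  have hBfin : volume B < ∞ := measure_ball_lt_top
  have hB0 : 0 < volume.real B :=
    ENNReal.toReal_pos (Metric.measure_ball_pos _ _ (by positivity)).ne' hBfin.ne
  -- The normalization gives φ̂(0) = 1, and the radius ηc with c‖u‖ ≤ q(u) gives |⟨w, u⟩| ≤ η q(u)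
  -- on the support. Smoothness is not needed, only φ̂ ∈ L².
  set φ : EuclideanSpace ℝ (Fin d) → ℂ :=
    B.indicator fun _ => (((volume.real B)⁻¹ : ℝ) : ℂ) with hφ
  have hφi : Integrable φ := (integrable_indicator_iff hBm).2 (integrableOn_const hBfin.ne)
  have hφ2 : MemLp φ 2 := memLp_indicator_const 2 hBm _ (Or.inr hBfin.ne)
  have hφ1 : 𝓕 φ 0 = 1 := by
    rw [Real.fourier_eq']
    simp only [inner_zero_right, mul_zero, Complex.ofReal_zero, zero_mul, Complex.exp_zero,
      one_smul]
    rw [hφ, integral_indicator hBm, setIntegral_const, Complex.real_smul, ← Complex.ofReal_mul,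
      mul_inv_cancel₀ hB0.ne', Complex.ofReal_one]
  have hφq : ∀ w, φ w ≠ 0 → ∀ u, |inner ℝ w u| ≤ η * q u := fun w hw u => by
    have hwB : w ∈ B := by
      by_contra h; exact hw (Set.indicator_of_notMem h _)
    have h1 : ‖w‖ ≤ η * c := (mem_ball_zero_iff.1 hwB).le
    calc |inner ℝ w u| ≤ ‖w‖ * ‖u‖ := abs_real_inner_le_norm _ _
      _ ≤ η * c * ‖u‖ := mul_le_mul_of_nonneg_right h1 (norm_nonneg _)
      _ ≤ η * q u := by rw [mul_assoc]; exact mul_le_mul_of_nonneg_left (hcq u) hη0.le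
  have hφfin : ∫⁻ u, ‖𝓕 φ u‖ₑ ^ 2 ≠ ∞ := by
    rw [lintegral_enorm_sq_fourier hφi hφ2, lintegral_enorm_sq_eq_eLpNorm]
    have := hφ2.2.ne
    finiteness
  have : Countable Ω := hc.to_subtype
  obtain ⟨W, hWm, hWd, hWc, hWv⟩ := exists_disjoint_voronoi_cells hD hΩ hc hne
  have hWe : ∀ i : Ω, ∀ z ∈ W i, q ((i : EuclideanSpace ℝ (Fin d)) - z) ≤ ρ := fun i z hz =>
    gauge_polarSet_le_toReal_gap hgap' i.2 (hWv i hz)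
  have hqadd : ∀ u v, q (u + v) ≤ q u + q v := gauge_add_le (convex_polarSet D)
    (absorbent_nhds_zero (polarSet_mem_nhds_zero hD))
  obtain ⟨C₁, hC₁, hup⟩ := exists_tsum_measure_mul_enorm_sq_fourier_le (ι := Ω)
    (V := EuclideanSpace ℝ (Fin d)) (R := R₀) (r := ρ / c) hR₀
  set U : Set (EuclideanSpace ℝ (Fin d)) := {u | q u < η} with hU
  have hUo : IsOpen U := isOpen_lt hqc continuous_const
  have hU0 : volume U ≠ 0 := (hUo.measure_pos _ ⟨0, by simp [hU, hq, hη0]⟩).ne'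
  have hUfin : volume U ≠ ∞ := by
    refine ne_of_lt (lt_of_le_of_lt (measure_mono ?_)
      (measure_ball_lt_top (x := (0 : EuclideanSpace ℝ (Fin d))) (r := η / c)))
    intro u hu
    rw [mem_ball_zero_iff, lt_div_iff₀ hc0, mul_comm]
    exact (hcq u).trans_lt hu
  set P := ∫⁻ u, ‖𝓕 φ u‖ₑ ^ 2 with hP
  set A : ℝ≥0∞ := volume U * ENNReal.ofReal (Real.cos s) ^ 2 with hA
  have hcos0 : ENNReal.ofReal (Real.cos s) ≠ 0 := (ENNReal.ofReal_pos.2 hcos).ne'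
  have hA0 : A ≠ 0 := mul_ne_zero hU0 (pow_ne_zero _ hcos0)
  have hAfin : A ≠ ∞ := by finiteness
  refine ⟨A⁻¹ * (C₁ + P), by
    have := ENNReal.inv_ne_top.2 hA0
    finiteness, fun δ hδ => ?_⟩
  -- Only M depends on δ; the constant built from A, C₁ and P was fixed before.
  obtain ⟨M, hM⟩ := exists_setLIntegral_norm_gt_le (h := fun u => ‖𝓕 φ u‖ₑ ^ 2)
    (((continuous_fourier_of_integrable hφi).enorm.measurable).pow_const 2) hφfin hδ
  refine ⟨M, by positivity, fun R hR K => ?_⟩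
  refine iSup₂_le fun f hf => iSup_le fun hf1 => ?_
  have hfD : f ∈ L2On D := hR hf
  have hfi := integrable_of_mem_L2On hD.isCompact hfD
  have hfD' : ∀ᵐ x, f x ≠ 0 → x ∈ D := by
    filter_upwards [show ∀ᵐ x, x ∉ D → f x = 0 from hfD] with x hx h0
    by_contra h; exact h0 (hx h)
  have key := measure_mul_setLIntegral_enorm_sq_fourier_le hfi hφi hφ1 (q := q) (ε := η)
    (hfD'.mono fun x hx h0 u => abs_inner_le_gauge_polarSet hD (hx h0) u) hφq hs0 (by linarith)
    hη0.le hqadd hρη hWc hWe K M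
  have hub := hup (fun i => i) W hWm hWd (fun i z hz => by
      rw [le_div_iff₀ hc0, mul_comm]
      exact (hcq _).trans (hWe i z hz)) f hfi (Lp.memLp f)
    (hfD'.mono fun x hx h0 => hDR x (hx h0))
  rw [lintegral_enorm_sq_coeFn_of_norm_eq_one hf1, mul_one] at hub
  have hsamp : ∑' i : Ω, {i : Ω | K < ‖(i : EuclideanSpace ℝ (Fin d))‖}.indicator
      (fun i => volume (W i) * ‖fourierFn f i‖ₑ ^ 2) i ≤
      samplingResidual D R Ω K := by
    refine le_trans ?_ (le_iSup₂_of_le f hf (le_iSup_of_le hf1 le_rfl))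
    set g : EuclideanSpace ℝ (Fin d) → ℝ≥0∞ := fun ω =>
      voronoiWeight (polarSet D) Ω ω * ‖fourierFn f ω‖ₑ ^ 2 with hg
    have e1 : ∑' ω : {ω : EuclideanSpace ℝ (Fin d) // ω ∈ Ω ∧ K < ‖ω‖}, g ω =
        ∑' ω : Ω, {ω : EuclideanSpace ℝ (Fin d) | K < ‖ω‖}.indicator g ω := by
      refine (tsum_subtype {ω : EuclideanSpace ℝ (Fin d) | ω ∈ Ω ∧ K < ‖ω‖} g).trans ?_
      rw [tsum_subtype Ω, Set.indicator_indicator]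
      rfl
    show _ ≤ ∑' ω : {ω : EuclideanSpace ℝ (Fin d) // ω ∈ Ω ∧ K < ‖ω‖}, g ω
    rw [e1]
    refine ENNReal.tsum_le_tsum fun i => ?_
    by_cases hi : K < ‖(i : EuclideanSpace ℝ (Fin d))‖
    · rw [Set.indicator_of_mem (by exact hi), Set.indicator_of_mem (by exact hi)]
      exact mul_le_mul' (measure_mono (hWv i)) le_rfl
    · rw [Set.indicator_of_notMem (by exact hi)]; exact bot_le
  rw [← mul_assoc] at key
  have h2 : A * ∫⁻ ξ in {ξ : EuclideanSpace ℝ (Fin d) | K + M < ‖ξ‖}, ‖fourierFn f ξ‖ₑ ^ 2 ≤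
      (C₁ + P) * (δ + samplingResidual D R Ω K) := by
    refine key.trans ?_
    refine (add_le_add (mul_le_mul' hub hM) (mul_le_mul' hsamp le_rfl)).trans ?_
    rw [add_mul, mul_add, mul_add, mul_comm _ P]
    exact add_le_add le_self_add le_add_self
  rw [mul_assoc, ← one_mul (∫⁻ ξ in _, _), ← ENNReal.inv_mul_cancel hA0 hAfin, mul_assoc]
  exact mul_le_mul' le_rfl h2

/-- As N^α ≥ 1, the additive shift M is absorbed by passing from c to c + M. -/
theorem hasResidualDecay_of_gap_lt (hD : IsCenteredSymmetricConvexBody D)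
    {R : ℕ → Submodule ℂ (Lp ℂ 2 (volume : Measure (EuclideanSpace ℝ (Fin d))))}
    (hR : ∀ N : ℕ, 1 ≤ N → R N ≤ L2On D) {α : ℝ} (hα : 0 < α)
    {Ω : Set (EuclideanSpace ℝ (Fin d))} (hΩ : IsClosed Ω) (hc : Ω.Countable)
    (hgap : gap (polarSet D) Ω < 1 / 4) (h : HasResidualDecayWrt D R Ω α) :
    HasResidualDecay R α := by
  obtain ⟨C, hC, hmain⟩ := exists_intrinsicResidual_le hD hΩ hc hgap
  intro θ hθ
  -- The localization error and the sampling residual are each at most δ, and 2Cδ ≤ θ; the +1 covers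
  -- C = 0.
  set δ : ℝ := θ / (2 * (C.toReal + 1)) with hδ
  have hC0 : 0 ≤ C.toReal := ENNReal.toReal_nonneg
  have hδ0 : 0 < δ := by positivity
  obtain ⟨c, hc0, hcs⟩ := h δ hδ0
  obtain ⟨M, hM0, hM⟩ := hmain (ENNReal.ofReal δ) (ENNReal.ofReal_pos.2 hδ0)
  refine ⟨c + M, by positivity, iSup₂_le fun N hN => ?_⟩
  have hN1 : (1 : ℝ) ≤ (N : ℝ) ^ α := Real.one_le_rpow (by exact_mod_cast hN) hα.le
  have h1 : intrinsicResidual (R N) ((c + M) * (N : ℝ) ^ α) ≤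
      intrinsicResidual (R N) (c * (N : ℝ) ^ α + M) := by
    refine iSup₂_mono fun f hf => iSup_mono fun _ => lintegral_mono_set fun ξ hξ => ?_
    have hξ' : (c + M) * (N : ℝ) ^ α < ‖ξ‖ := hξ
    show c * (N : ℝ) ^ α + M < ‖ξ‖
    nlinarith
  refine h1.trans ((hM (R N) (hR N hN) _).trans ?_)
  have h2 := (le_iSup₂ (f := fun N (_ : 1 ≤ N) => samplingResidual D (R N) Ω (c * (N : ℝ) ^ α))
    N hN).trans hcs
  refine (mul_le_mul' le_rfl (add_le_add le_rfl h2)).trans ?_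
  rw [← ENNReal.ofReal_toReal hC, ← ENNReal.ofReal_add hδ0.le hδ0.le, ← ENNReal.ofReal_mul hC0]
  refine ENNReal.ofReal_le_ofReal ?_
  rw [hδ]
  field_simp
  nlinarith

end Residual

/-! ### Parseval on the unit cube. -/

section Cube

variable {d : ℕ}

/-- The point of the integer lattice with the given coordinates. -/
noncomputable def latticePoint (n : Fin d → ℤ) : EuclideanSpace ℝ (Fin d) := WithLp.toLp 2 fun i => (n i : ℝ)

@[simp]
theorem latticePoint_apply (n : Fin d → ℤ) (i : Fin d) : latticePoint n i = n i := rfl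

theorem integral_euclideanSpace_eq (F : EuclideanSpace ℝ (Fin d) → ℂ) :
    ∫ x, F x = ∫ y : Fin d → ℝ, F (WithLp.toLp 2 y) :=
  ((PiLp.volume_preserving_toLp (Fin d)).integral_comp
    (MeasurableEquiv.toLp 2 (Fin d → ℝ)).measurableEmbedding F).symm

theorem lintegral_euclideanSpace_eq (F : EuclideanSpace ℝ (Fin d) → ℝ≥0∞) :
    ∫⁻ x, F x = ∫⁻ y : Fin d → ℝ, F (WithLp.toLp 2 y) :=
  ((PiLp.volume_preserving_toLp (Fin d)).lintegral_comp_emb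
    (MeasurableEquiv.toLp 2 (Fin d → ℝ)).measurableEmbedding F).symm

theorem setOf_forall_mem_Ioc_ae_eq (d : ℕ) :
    ({x : Fin d → ℝ | ∀ i, x i ∈ Set.Ioc (-1 / 2 : ℝ) (-1 / 2 + 1)} : Set (Fin d → ℝ)) =ᵐ[volume]
      ({x | ∀ i, x i ∈ Set.Icc (-1 / 2 : ℝ) (1 / 2)} : Set (Fin d → ℝ)) := by
  have h := Measure.univ_pi_Ioc_ae_eq_Icc (μ := fun _ : Fin d => (volume : Measure ℝ))
    (f := fun _ => (-1 / 2 : ℝ)) (g := fun _ => (1 / 2 : ℝ))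
  have e1 : {x : Fin d → ℝ | ∀ i, x i ∈ Set.Ioc (-1 / 2 : ℝ) (-1 / 2 + 1)} =
      Set.univ.pi fun _ => Set.Ioc (-1 / 2 : ℝ) (1 / 2) := by
    ext x; norm_num [Set.mem_pi]
  have e2 : {x : Fin d → ℝ | ∀ i, x i ∈ Set.Icc (-1 / 2 : ℝ) (1 / 2)} =
      Set.Icc (fun _ => (-1 / 2 : ℝ)) (fun _ => (1 / 2 : ℝ)) := by
    ext x; simp [Pi.le_def, forall_and]
  rw [e1, e2]
  exact h

/-- **Parseval's identity** for square-integrable functions supported in the unit cube. -/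
theorem tsum_enorm_sq_fourier_latticePoint {h : EuclideanSpace ℝ (Fin d) → ℂ} (h2 : MemLp h 2)
    (hD : ∀ᵐ x, x ∉ unitCube d → h x = 0) :
    ∑' n : Fin d → ℤ, ‖𝓕 h (latticePoint n)‖ₑ ^ 2 = ∫⁻ x, ‖h x‖ₑ ^ 2 := by
  set a : Fin d → ℝ := fun _ => -1 / 2 with ha
  set S : Set (Fin d → ℝ) := {x | ∀ i, x i ∈ Set.Ioc (a i) (a i + 1)} with hS
  have hSm : MeasurableSet S := MeasurableSet.univ_pi' fun i => measurableSet_Ioc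
  set h' : (Fin d → ℝ) → ℂ := fun y => h (WithLp.toLp 2 y) with hh'
  -- The torus is parametrized by a half-open cube, which differs from the closed one by a null set.
  have hD' : ∀ᵐ y : Fin d → ℝ, y ∉ S → h' y = 0 := by
    have h3 := (PiLp.volume_preserving_toLp (Fin d)).quasiMeasurePreserving.ae hD
    filter_upwards [h3, setOf_forall_mem_Ioc_ae_eq d] with y hy hy2 hyS
    refine hy fun hyc => hyS ?_
    exact (iff_of_eq hy2).2 hyc
  set H : UnitAddTorus (Fin d) → ℂ := fun t => h' (UnitAddTorus.measurableEquivPiIoc a t).1 with hH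
  have hHx : ∀ x ∈ S, H (fun i => (x i : UnitAddCircle)) = h' x := by
    intro x hx
    have : (fun i => (x i : UnitAddCircle)) = (UnitAddTorus.measurableEquivPiIoc a).symm ⟨x, hx⟩ :=
      (UnitAddTorus.coe_symm_measurableEquivPiIoc_apply a ⟨x, hx⟩).symm
    rw [hH]
    simp only
    rw [this, MeasurableEquiv.apply_symm_apply]
  have hH2 := (((h2.comp_measurePreserving (PiLp.volume_preserving_toLp (Fin d))).restrict
    S).comp_measurePreserving (measurePreserving_subtype_coe hSm)).comp_measurePreserving
      (UnitAddTorus.measurePreserving_equivPiIoc a)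
  have hpars := UnitAddTorus.hasSum_sq_mFourierCoeff (hH2.toLp _)
  have hcoef : ∀ n, UnitAddTorus.mFourierCoeff (hH2.toLp _) n = 𝓕 h (latticePoint n) := by
    intro n
    have e1 : UnitAddTorus.mFourierCoeff (hH2.toLp _) n = UnitAddTorus.mFourierCoeff H n :=
      integral_congr_ae (by
        filter_upwards [hH2.coeFn_toLp] with t ht
        rw [ht]; rfl)
    rw [e1, UnitAddTorus.mFourierCoeff_eq_integral H n a, Real.fourier_eq',
      integral_euclideanSpace_eq]
    have e2 : ∫ y : Fin d → ℝ, Complex.exp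
          ((-2 * Real.pi * inner ℝ (WithLp.toLp 2 y) (latticePoint n) : ℝ) * Complex.I) •
            h (WithLp.toLp 2 y) =
        ∫ y in S, Complex.exp
          ((-2 * Real.pi * inner ℝ (WithLp.toLp 2 y) (latticePoint n) : ℝ) * Complex.I) •
            h (WithLp.toLp 2 y) := by
      refine (setIntegral_eq_integral_of_ae_compl_eq_zero ?_).symm
      filter_upwards [hD'] with y hy hyS
      have : h (WithLp.toLp 2 y) = 0 := hy hyS
      rw [this, smul_zero]
    rw [e2]
    refine setIntegral_congr_fun hSm fun x hx => ?_
    simp only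
    rw [hHx x hx]
    congr 1
    rw [UnitAddTorus.mFourier, ContinuousMap.coe_mk]
    simp only [fourier_coe_apply, PiLp.inner_apply, latticePoint_apply]
    rw [← Complex.exp_sum]
    congr 1
    push_cast
    rw [Finset.mul_sum, Finset.sum_mul]
    refine Finset.sum_congr rfl fun i _ => ?_
    simp
    ring
  have hint := UnitAddTorus.lintegral_preimage (fun t => ‖H t‖ₑ ^ 2) a
  have e3 : ∑' n : Fin d → ℤ, ‖𝓕 h (latticePoint n)‖ₑ ^ 2 =
      ENNReal.ofReal (∑' n, ‖UnitAddTorus.mFourierCoeff (hH2.toLp _) n‖ ^ 2) := by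
    rw [ENNReal.ofReal_tsum_of_nonneg (fun n => by positivity) hpars.summable]
    refine tsum_congr fun n => ?_
    rw [hcoef, ENNReal.ofReal_pow (norm_nonneg _), ofReal_norm]
  rw [e3, hpars.tsum_eq, ofReal_integral_eq_lintegral_ofReal ((Lp.memLp _).integrable_norm_pow two_ne_zero)
    (Filter.Eventually.of_forall fun _ => by positivity), lintegral_euclideanSpace_eq]
  calc _ = ∫⁻ t : UnitAddTorus (Fin d), ‖H t‖ₑ ^ 2 ∂_ := lintegral_congr_ae (by
        filter_upwards [hH2.coeFn_toLp] with t ht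
        rw [ht, ENNReal.ofReal_pow (norm_nonneg _), ofReal_norm]; rfl)
    _ = ∫⁻ x in S, ‖H (fun i => (x i : UnitAddCircle))‖ₑ ^ 2 := hint
    _ = ∫⁻ x in S, ‖h' x‖ₑ ^ 2 := setLIntegral_congr_fun hSm fun x hx => by
        simp only [hHx x hx]
    _ = ∫⁻ x, ‖h' x‖ₑ ^ 2 := by
        rw [← lintegral_indicator hSm]
        refine lintegral_congr_ae ?_
        filter_upwards [hD'] with y hy
        by_cases hyS : y ∈ S
        · rw [Set.indicator_of_mem hyS]
        · rw [Set.indicator_of_notMem hyS, hy hyS]; simp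

end Cube

/-! ### Exponentials of integer frequency and their Fourier transforms. -/

section CubeExp

/-- The exponential of frequency `k` on `[-1/2, 1/2]`, extended by zero. -/
noncomputable def intervalExp (k : ℤ) : ℝ → ℂ :=
  (Set.Icc (-1 / 2 : ℝ) (1 / 2)).indicator fun t => Complex.exp ((2 * Real.pi * k * t : ℝ) * Complex.I)

theorem norm_intervalExp_le (k : ℤ) (t : ℝ) : ‖intervalExp k t‖ ≤ 1 := by
  unfold intervalExp
  refine (norm_indicator_le_norm_self _ _).trans ?_
  rw [Complex.norm_exp_ofReal_mul_I]

theorem measurable_intervalExp (k : ℤ) : Measurable (intervalExp k) :=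
  (by fun_prop : Measurable fun t : ℝ =>
    Complex.exp ((2 * Real.pi * k * t : ℝ) * Complex.I)).indicator measurableSet_Icc

theorem memLp_intervalExp (k : ℤ) (p : ℝ≥0∞) : MemLp (intervalExp k) p := by
  have h : MemLp ((Set.Icc (-1 / 2 : ℝ) (1 / 2)).indicator fun _ => (1 : ℂ)) p :=
    memLp_indicator_const p measurableSet_Icc _ (Or.inr measure_Icc_lt_top.ne)
  refine h.of_le (measurable_intervalExp k).aestronglyMeasurable
    (Filter.Eventually.of_forall fun t => ?_)
  by_cases ht : t ∈ Set.Icc (-1 / 2 : ℝ) (1 / 2)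
  · rw [Set.indicator_of_mem ht, norm_one]; exact norm_intervalExp_le k t
  · rw [intervalExp, Set.indicator_of_notMem ht, Set.indicator_of_notMem ht]

theorem integrable_intervalExp (k : ℤ) : Integrable (intervalExp k) :=
  memLp_one_iff_integrable.1 (memLp_intervalExp k 1)

theorem fourier_intervalExp (k : ℤ) (t : ℝ) :
    𝓕 (intervalExp k) t =
      ∫ x in (-1 / 2 : ℝ)..(1 / 2), Complex.exp (2 * Real.pi * (k - t) * Complex.I * x) := by
  rw [Real.fourier_real_eq_integral_exp_smul, intervalIntegral.integral_of_le (by norm_num),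
    ← integral_Icc_eq_integral_Ioc, ← integral_indicator measurableSet_Icc]
  congr 1
  ext x
  by_cases hx : x ∈ Set.Icc (-1 / 2 : ℝ) (1 / 2)
  · rw [intervalExp, Set.indicator_of_mem hx, Set.indicator_of_mem hx, smul_eq_mul,
      ← Complex.exp_add]
    congr 1
    push_cast
    ring
  · rw [intervalExp, Set.indicator_of_notMem hx, Set.indicator_of_notMem hx, smul_zero]

theorem fourier_intervalExp_of_ne (k : ℤ) {t : ℝ} (ht : t ≠ k) :
    𝓕 (intervalExp k) t =
      (Complex.exp (Real.pi * (k - t) * Complex.I) - Complex.exp (-(Real.pi * (k - t) * Complex.I))) /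
        (2 * Real.pi * (k - t) * Complex.I) := by
  have h0 : (2 * Real.pi * (k - t) * Complex.I : ℂ) ≠ 0 := by
    have : (k - t : ℂ) ≠ 0 := by
      rw [← Complex.ofReal_intCast, ← Complex.ofReal_sub]
      exact Complex.ofReal_ne_zero.2 (sub_ne_zero.2 ht.symm)
    have hpi : (Real.pi : ℂ) ≠ 0 := Complex.ofReal_ne_zero.2 Real.pi_ne_zero
    exact mul_ne_zero (mul_ne_zero (mul_ne_zero two_ne_zero hpi) this) Complex.I_ne_zero
  rw [fourier_intervalExp, integral_exp_mul_complex h0]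
  congr 3
  · push_cast; ring
  · push_cast; ring

/-- The transform is a shifted sinc; the factor 1/π in its decay is discarded. -/
theorem norm_fourier_intervalExp_le (k : ℤ) {t : ℝ} (ht : t ≠ k) :
    ‖𝓕 (intervalExp k) t‖ ≤ 1 / |t - k| := by
  have h1 : ∀ r : ℝ, ‖Complex.exp (Real.pi * r * Complex.I)‖ = 1 := fun r => by
    rw [← Complex.ofReal_mul, Complex.norm_exp_ofReal_mul_I]
  have h2 := h1 (k - t)
  have h3 := h1 (-(k - t))
  push_cast at h2 h3
  rw [mul_neg, neg_mul] at h3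
  have h4 : 0 < |t - k| := abs_pos.2 (sub_ne_zero.2 ht)
  rw [fourier_intervalExp_of_ne k ht, norm_div]
  have e : ‖(2 * Real.pi * (k - t) * Complex.I : ℂ)‖ = 2 * Real.pi * |t - k| := by
    rw [← Complex.ofReal_intCast, ← Complex.ofReal_sub, norm_mul, norm_mul, norm_mul,
      Complex.norm_real, Complex.norm_real, Complex.norm_I, Real.norm_eq_abs, Real.norm_eq_abs,
      abs_of_pos Real.pi_pos, abs_sub_comm]
    norm_num
  rw [e]
  refine (div_le_div_of_nonneg_right ((norm_sub_le _ _).trans_eq (by rw [h2, h3]))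
    (by positivity)).trans ?_
  rw [div_le_div_iff₀ (by positivity) h4]
  nlinarith [Real.pi_gt_three]

theorem fourier_intervalExp_int (k l : ℤ) :
    𝓕 (intervalExp k) (l : ℝ) = if k = l then 1 else 0 := by
  split_ifs with h
  · rw [fourier_intervalExp, h]; norm_num
  · rw [fourier_intervalExp_of_ne k (by exact_mod_cast Ne.symm h)]
    have e1 : (Real.pi * (k - ((l : ℝ) : ℂ)) * Complex.I : ℂ) = ((k - l : ℤ) : ℂ) * (Real.pi * Complex.I) := by
      push_cast; ring
    rw [e1, Complex.exp_neg, Complex.exp_int_mul, Complex.exp_pi_mul_I, ← inv_zpow]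
    norm_num

/-- By Plancherel this is the l-th Fourier coefficient of the k-th exponential. -/
theorem integral_fourier_intervalExp_mul_conj (k l : ℤ) :
    ∫ t, 𝓕 (intervalExp k) t * (starRingEnd ℂ) (𝓕 (intervalExp l) t) = if k = l then 1 else 0 := by
  rw [integral_conj_fourier_mul_fourier (integrable_intervalExp l) (memLp_intervalExp l 2)
    (integrable_intervalExp k) (memLp_intervalExp k 2), ← fourier_intervalExp_int k l,
    Real.fourier_real_eq_integral_exp_smul]
  congr 1
  ext x
  by_cases hx : x ∈ Set.Icc (-1 / 2 : ℝ) (1 / 2)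
  · have : (starRingEnd ℂ) (intervalExp l x) = Complex.exp ((-2 * Real.pi * x * l : ℝ) * Complex.I) := by
      rw [intervalExp, Set.indicator_of_mem hx, ← Complex.exp_conj]
      congr 1
      rw [map_mul, Complex.conj_ofReal, Complex.conj_I]
      push_cast
      ring
    rw [this, smul_eq_mul, mul_comm]
  · rw [intervalExp, Set.indicator_of_notMem hx, zero_mul, smul_zero]

theorem integrable_fourier_intervalExp_mul_conj (k l : ℤ) :
    Integrable fun t => 𝓕 (intervalExp k) t * (starRingEnd ℂ) (𝓕 (intervalExp l) t) :=
  (memLp_fourier (integrable_intervalExp k) (memLp_intervalExp k 2)).integrable_mul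
    (memLp_fourier (integrable_intervalExp l) (memLp_intervalExp l 2)).star

/-- This is the majorant 4/t² for a product of two transforms on |t| > M. -/
theorem integral_indicator_Ioi_inv_sq_abs {M : ℝ} (hM : 0 < M) :
    Integrable (fun t : ℝ => (Set.Ioi M).indicator (fun t => 4 * t ^ (-2 : ℝ)) |t|) ∧
    ∫ t : ℝ, (Set.Ioi M).indicator (fun t => 4 * t ^ (-2 : ℝ)) |t| = 8 / M := by
  have h : ∫ t : ℝ, (Set.Ioi M).indicator (fun t => 4 * t ^ (-2 : ℝ)) |t| = 8 / M := by
    rw [integral_comp_abs (f := (Set.Ioi M).indicator (fun t => 4 * t ^ (-2 : ℝ))),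
      setIntegral_indicator measurableSet_Ioi,
      Set.inter_eq_right.2 (Set.Ioi_subset_Ioi hM.le), integral_const_mul,
      integral_Ioi_rpow_of_lt (by norm_num) hM]
    norm_num
    rw [Real.rpow_neg_one]
    ring
  refine ⟨?_, h⟩
  -- A non-integrable function would have integral 0, while the computed value 8/M is nonzero.
  by_contra hn
  rw [integral_undef hn] at h
  exact (by positivity : 8 / M ≠ 0) h.symm

theorem norm_integral_indicator_fourier_intervalExp_le {M : ℝ} (hM : 0 < M) {k l : ℤ}
    (hk : 2 * |(k : ℝ)| ≤ M) (hl : 2 * |(l : ℝ)| ≤ M) :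
    ‖∫ t, {t : ℝ | M < |t|}.indicator
      (fun t => 𝓕 (intervalExp k) t * (starRingEnd ℂ) (𝓕 (intervalExp l) t)) t‖ ≤ 8 / M := by
  obtain ⟨h1, h2⟩ := integral_indicator_Ioi_inv_sq_abs hM
  rw [← h2]
  refine norm_integral_le_of_norm_le h1 (Filter.Eventually.of_forall fun t => ?_)
  by_cases ht : M < |t|
  · rw [Set.indicator_of_mem (by exact ht), Set.indicator_of_mem (by exact ht)]
    -- When |t| > M ≥ 2|j|, the distance from t to j is at least |t|/2.
    have key : ∀ j : ℤ, 2 * |(j : ℝ)| ≤ M → ‖𝓕 (intervalExp j) t‖ ≤ 2 / |t| := fun j hj => by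
      have h3 : |t| / 2 ≤ |t - j| := by
        have := abs_sub_abs_le_abs_sub t j
        linarith
      have h4 : t ≠ j := by
        intro h; rw [h, sub_self, abs_zero, ← h] at h3; linarith
      refine (norm_fourier_intervalExp_le j h4).trans ?_
      rw [div_le_div_iff₀ (by linarith) (by linarith)]
      linarith
    rw [norm_mul, RCLike.norm_conj]
    refine (mul_le_mul (key k hk) (key l hl) (norm_nonneg _) (by positivity)).trans (le_of_eq ?_)
    rw [Real.rpow_neg (abs_nonneg t), show (2 : ℝ) = ((2 : ℕ) : ℝ) by norm_num, Real.rpow_natCast]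
    push_cast
    field_simp
    norm_num
  · rw [Set.indicator_of_notMem (by exact ht), Set.indicator_of_notMem (by exact ht), norm_zero]

variable {d : ℕ}

theorem integral_prod_coord_eq (u : Fin d → ℝ → ℂ) :
    ∫ x : EuclideanSpace ℝ (Fin d), ∏ j, u j (x j) = ∏ j, ∫ t, u j t := by
  rw [integral_euclideanSpace_eq]
  exact integral_fintype_prod_volume_eq_prod u

theorem integrable_prod_coord {u : Fin d → ℝ → ℂ} (hu : ∀ j, Integrable (u j)) :
    Integrable fun x : EuclideanSpace ℝ (Fin d) => ∏ j, u j (x j) := by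
  have h : Integrable (fun y : Fin d → ℝ => ∏ j, u j (y j)) := Integrable.fintype_prod hu
  exact (PiLp.volume_preserving_ofLp (Fin d)).integrable_comp_of_integrable h

/-- The exponential of integer frequency `n` on the unit cube, extended by zero. -/
noncomputable def cubeExp (n : Fin d → ℤ) (x : EuclideanSpace ℝ (Fin d)) : ℂ := ∏ j, intervalExp (n j) (x j)

theorem integrable_cubeExp (n : Fin d → ℤ) : Integrable (cubeExp n) :=
  integrable_prod_coord fun j => integrable_intervalExp (n j)

theorem norm_cubeExp_le (n : Fin d → ℤ) (x : EuclideanSpace ℝ (Fin d)) : ‖cubeExp n x‖ ≤ 1 := by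
  rw [cubeExp, norm_prod]
  exact Finset.prod_le_one (fun _ _ => norm_nonneg _) fun j _ => norm_intervalExp_le _ _

theorem memLp_cubeExp (n : Fin d → ℤ) : MemLp (cubeExp n) 2 :=
  (memLp_two_iff_integrable_sq_norm (integrable_cubeExp n).1).2 <|
    (integrable_cubeExp n).norm.mono' ((integrable_cubeExp n).1.norm.pow 2)
      (Filter.Eventually.of_forall fun x => by
        rw [Real.norm_of_nonneg (by positivity)]
        nlinarith [norm_nonneg (cubeExp n x), norm_cubeExp_le n x])

theorem cubeExp_eq_zero (n : Fin d → ℤ) {x : EuclideanSpace ℝ (Fin d)} (hx : x ∉ unitCube d) :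
    cubeExp n x = 0 := by
  obtain ⟨i, hi⟩ := not_forall.1 hx
  exact Finset.prod_eq_zero (Finset.mem_univ i) (Set.indicator_of_notMem hi _)

theorem fourier_cubeExp (n : Fin d → ℤ) (ξ : EuclideanSpace ℝ (Fin d)) :
    𝓕 (cubeExp n) ξ = ∏ j, 𝓕 (intervalExp (n j)) (ξ j) := by
  rw [Real.fourier_eq']
  simp only [Real.fourier_real_eq_integral_exp_smul]
  rw [← integral_prod_coord_eq fun j t =>
    Complex.exp ((-2 * Real.pi * t * ξ j : ℝ) * Complex.I) • intervalExp (n j) t]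
  congr 1
  ext x
  simp only [smul_eq_mul]
  rw [Finset.prod_mul_distrib, cubeExp, ← Complex.exp_sum]
  congr 2
  rw [PiLp.inner_apply, ← Finset.sum_mul]
  push_cast
  rw [Finset.mul_sum]
  congr 1
  refine Finset.sum_congr rfl fun j _ => ?_
  simp
  ring

theorem fourier_cubeExp_latticePoint (n m : Fin d → ℤ) :
    𝓕 (cubeExp n) (latticePoint m) = if n = m then 1 else 0 := by
  rw [fourier_cubeExp]
  simp only [latticePoint_apply, fourier_intervalExp_int]
  split_ifs with h
  · simp [h]
  · obtain ⟨i, hi⟩ := Function.ne_iff.1 h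
    exact Finset.prod_eq_zero (Finset.mem_univ i) (if_neg hi)

end CubeExp

/-! ### Energy of a trigonometric partial sum far outside its frequency box. -/

section CubeTail

variable {d : ℕ}

/-- The integer frequencies with all coordinates at most `L` in absolute value. -/
noncomputable def frequencyBox (d L : ℕ) : Finset (Fin d → ℤ) := Fintype.piFinset fun _ => Finset.Icc (-(L : ℤ)) L

theorem abs_le_of_mem_frequencyBox {L : ℕ} {n : Fin d → ℤ} (hn : n ∈ frequencyBox d L) (i : Fin d) :
    |(n i : ℝ)| ≤ L := by
  have := Finset.mem_Icc.1 (Fintype.mem_piFinset.1 hn i)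
  rw [abs_le]
  exact ⟨by exact_mod_cast this.1, by exact_mod_cast this.2⟩

theorem card_filter_frequencyBox_le (L : ℕ) (n : Fin d → ℤ) (i : Fin d) :
    ((frequencyBox d L).filter fun m => ∀ j, j ≠ i → n j = m j).card ≤ 2 * L + 1 := by
  have h := Finset.card_le_card_of_injOn (s := (frequencyBox d L).filter fun m => ∀ j, j ≠ i → n j = m j)
    (t := Finset.Icc (-(L : ℤ)) L) (fun m => m i)
    (fun m hm => Fintype.mem_piFinset.1 (Finset.mem_filter.1 hm).1 i)
    (fun m hm m' hm' h => by
      have h1 := (Finset.mem_filter.1 (Finset.mem_coe.1 hm)).2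
      have h2 := (Finset.mem_filter.1 (Finset.mem_coe.1 hm')).2
      funext j
      by_cases hj : j = i
      · rw [hj]; exact h
      · rw [← h1 j hj, h2 j hj])
  rw [Int.card_Icc] at h
  omega

/-- The form `⟨cubeExp n, cubeExp m⟩` restricted to frequencies with `i`-th coordinate above `M`. -/
theorem norm_integral_indicator_prod_fourier_le {L : ℕ} {M : ℝ} (hM : 0 < M) (hLM : 2 * (L : ℝ) ≤ M)
    (i : Fin d) {n m : Fin d → ℤ} (hn : n ∈ frequencyBox d L) (hm : m ∈ frequencyBox d L) :
    Integrable ({ξ : EuclideanSpace ℝ (Fin d) | M < |ξ i|}.indicator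
      fun ξ => 𝓕 (cubeExp n) ξ * (starRingEnd ℂ) (𝓕 (cubeExp m) ξ)) ∧
    ‖∫ ξ, {ξ : EuclideanSpace ℝ (Fin d) | M < |ξ i|}.indicator
      (fun ξ => 𝓕 (cubeExp n) ξ * (starRingEnd ℂ) (𝓕 (cubeExp m) ξ)) ξ‖ ≤
      if ∀ j, j ≠ i → n j = m j then 8 / M else 0 := by
  set w : Fin d → ℝ → ℂ := fun j t =>
    𝓕 (intervalExp (n j)) t * (starRingEnd ℂ) (𝓕 (intervalExp (m j)) t) with hw
  set u : Fin d → ℝ → ℂ := fun j => if j = i then {t : ℝ | M < |t|}.indicator (w j) else w j with hu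
  have hset : MeasurableSet {t : ℝ | M < |t|} := measurableSet_lt measurable_const (by fun_prop)
  have hwi : ∀ j, Integrable (w j) := fun j => integrable_fourier_intervalExp_mul_conj _ _
  have hui : ∀ j, Integrable (u j) := fun j => by
    rw [hu]
    simp only
    split_ifs
    · exact (hwi j).indicator hset
    · exact hwi j
  have e : ({ξ : EuclideanSpace ℝ (Fin d) | M < |ξ i|}.indicator
      fun ξ => 𝓕 (cubeExp n) ξ * (starRingEnd ℂ) (𝓕 (cubeExp m) ξ)) = fun ξ => ∏ j, u j (ξ j) := by
    ext ξ
    by_cases hξ : M < |ξ i|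
    · rw [Set.indicator_of_mem (by exact hξ), fourier_cubeExp, fourier_cubeExp, map_prod,
        ← Finset.prod_mul_distrib]
      refine Finset.prod_congr rfl fun j _ => ?_
      rw [hu]
      simp only
      split_ifs with h
      · rw [Set.indicator_of_mem (by rw [h]; exact hξ)]
      · rfl
    · rw [Set.indicator_of_notMem (by exact hξ)]
      refine (Finset.prod_eq_zero (Finset.mem_univ i) ?_).symm
      rw [hu]
      simp only [if_true]
      exact Set.indicator_of_notMem (by exact hξ) _
  rw [e]
  refine ⟨integrable_prod_coord hui, ?_⟩
  rw [integral_prod_coord_eq]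
  -- Only coordinate i is truncated, so in every other coordinate orthonormality survives and the
  -- entry vanishes unless n and m agree there.
  have hne : ∀ j, j ≠ i → ∫ t, u j t = if n j = m j then 1 else 0 := fun j hj => by
    rw [← integral_fourier_intervalExp_mul_conj (n j) (m j), hu]
    simp only [if_neg hj, hw]
  split_ifs with h
  · rw [Finset.prod_eq_single i (fun j _ hj => by rw [hne j hj, if_pos (h j hj)])
      (fun h => absurd (Finset.mem_univ i) h)]
    rw [hu]
    simp only [if_true]
    exact norm_integral_indicator_fourier_intervalExp_le hM
      (by linarith [abs_le_of_mem_frequencyBox hn i]) (by linarith [abs_le_of_mem_frequencyBox hm i])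
  · push Not at h
    obtain ⟨j, hj, hj'⟩ := h
    rw [Finset.prod_eq_zero (Finset.mem_univ j) (by rw [hne j hj, if_neg hj']), norm_zero]

/-- A Schur test for a finite symmetric relation with bounded degree. -/
theorem sum_sum_ite_mul_le {ι : Type*} (s : Finset ι) (r : ι → ι → Prop) [DecidableRel r]
    (hr : ∀ n m, r n m → r m n) {k : ℕ} (hk : ∀ n ∈ s, (s.filter (r n)).card ≤ k) {κ : ℝ} (hκ : 0 ≤ κ)
    (a : ι → ℝ) :
    ∑ n ∈ s, ∑ m ∈ s, a n * a m * (if r n m then κ else 0) ≤ κ * k * ∑ n ∈ s, a n ^ 2 := by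
  -- Uses a_n a_m ≤ (a_n² + a_m²)/2; by symmetry of r the two halves have equal sums.
  have h1 : ∑ n ∈ s, ∑ m ∈ s, a n * a m * (if r n m then κ else 0) ≤
      ∑ n ∈ s, ∑ m ∈ s, ((a n ^ 2 / 2) * (if r n m then κ else 0) +
        (a m ^ 2 / 2) * (if r m n then κ else 0)) := by
    refine Finset.sum_le_sum fun n _ => Finset.sum_le_sum fun m _ => ?_
    by_cases h : r n m
    · rw [if_pos h, if_pos (hr _ _ h)]
      nlinarith [mul_nonneg hκ (sq_nonneg (a n - a m))]
    · rw [if_neg h, if_neg (fun h' => h (hr _ _ h'))]; simp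
  refine h1.trans ?_
  have h2 : ∑ n ∈ s, ∑ m ∈ s, (a n ^ 2 / 2) * (if r n m then κ else 0) ≤
      κ * k * ∑ n ∈ s, a n ^ 2 / 2 := by
    rw [Finset.mul_sum]
    refine Finset.sum_le_sum fun n hn => ?_
    rw [← Finset.mul_sum, ← Finset.sum_filter, Finset.sum_const, nsmul_eq_mul]
    have : ((s.filter (r n)).card : ℝ) ≤ k := by exact_mod_cast hk n hn
    have h3 := mul_le_mul_of_nonneg_left this (mul_nonneg hκ (by positivity : 0 ≤ a n ^ 2 / 2))
    linarith
  simp_rw [Finset.sum_add_distrib]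
  rw [Finset.sum_comm (f := fun n m => (a m ^ 2 / 2) * (if r m n then κ else 0))]
  have h4 : ∑ n ∈ s, a n ^ 2 = 2 * ∑ n ∈ s, a n ^ 2 / 2 := by
    rw [Finset.mul_sum]; exact Finset.sum_congr rfl fun _ _ => by ring
  rw [h4]
  linarith

/-- Expanding the square gives a quadratic form in the truncated Gram matrix. A frequency is related
to at most 2L + 1 others, one for each value of coordinate i, and the Schur test applies. -/
theorem setLIntegral_enorm_sq_sum_fourier_cubeExp_le {L : ℕ} {M : ℝ} (hM : 0 < M)
    (hLM : 2 * (L : ℝ) ≤ M) (i : Fin d) (a : (Fin d → ℤ) → ℂ) :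
    ∫⁻ ξ in {ξ : EuclideanSpace ℝ (Fin d) | M < |ξ i|},
      ‖∑ n ∈ frequencyBox d L, a n * 𝓕 (cubeExp n) ξ‖ₑ ^ 2 ≤
      ENNReal.ofReal (8 / M * (2 * L + 1) * ∑ n ∈ frequencyBox d L, ‖a n‖ ^ 2) := by
  set T : Set (EuclideanSpace ℝ (Fin d)) := {ξ | M < |ξ i|} with hT
  have hTm : MeasurableSet T := measurableSet_lt measurable_const (by fun_prop)
  set G : EuclideanSpace ℝ (Fin d) → ℂ := fun ξ =>
    ∑ n ∈ frequencyBox d L, a n * 𝓕 (cubeExp n) ξ with hG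
  set Q : (Fin d → ℤ) → (Fin d → ℤ) → EuclideanSpace ℝ (Fin d) → ℂ := fun n m =>
    T.indicator fun ξ => 𝓕 (cubeExp n) ξ * (starRingEnd ℂ) (𝓕 (cubeExp m) ξ) with hQ
  have hexp : ∀ ξ, ((T.indicator (fun ξ => ‖G ξ‖ ^ 2) ξ : ℝ) : ℂ) =
      ∑ n ∈ frequencyBox d L, ∑ m ∈ frequencyBox d L, a n * (starRingEnd ℂ) (a m) * Q n m ξ := by
    intro ξ
    by_cases hξ : ξ ∈ T
    · rw [Set.indicator_of_mem hξ, ← Complex.normSq_eq_norm_sq, ← Complex.mul_conj, hG]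
      simp only
      rw [map_sum, Finset.sum_mul_sum]
      refine Finset.sum_congr rfl fun n _ => Finset.sum_congr rfl fun m _ => ?_
      rw [hQ]
      simp only
      rw [Set.indicator_of_mem hξ, map_mul]
      ring
    · rw [Set.indicator_of_notMem hξ, Complex.ofReal_zero]
      refine (Finset.sum_eq_zero fun n _ => Finset.sum_eq_zero fun m _ => ?_).symm
      rw [hQ]
      simp only
      rw [Set.indicator_of_notMem hξ, mul_zero]
  have hQi : ∀ n ∈ frequencyBox d L, ∀ m ∈ frequencyBox d L,
      Integrable fun ξ => a n * (starRingEnd ℂ) (a m) * Q n m ξ := fun n hn m hm =>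
    (norm_integral_indicator_prod_fourier_le hM hLM i hn hm).1.const_mul _
  have hint : Integrable fun ξ => ((T.indicator (fun ξ => ‖G ξ‖ ^ 2) ξ : ℝ) : ℂ) := by
    simp_rw [hexp]
    exact integrable_finsetSum _ fun n hn => integrable_finsetSum _ fun m hm => hQi n hn m hm
  have hint' : Integrable (T.indicator fun ξ => ‖G ξ‖ ^ 2) := by
    simpa using hint.re
  have hnn : ∀ ξ, 0 ≤ T.indicator (fun ξ => ‖G ξ‖ ^ 2) ξ := fun ξ =>
    Set.indicator_nonneg (fun _ _ => by positivity) _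
  have e1 : ∫⁻ ξ in T, ‖G ξ‖ₑ ^ 2 = ENNReal.ofReal (∫ ξ, T.indicator (fun ξ => ‖G ξ‖ ^ 2) ξ) := by
    rw [ofReal_integral_eq_lintegral_ofReal hint' (Filter.Eventually.of_forall hnn),
      ← lintegral_indicator hTm]
    refine lintegral_congr fun ξ => ?_
    by_cases hξ : ξ ∈ T
    · rw [Set.indicator_of_mem hξ, Set.indicator_of_mem hξ, ENNReal.ofReal_pow (norm_nonneg _),
        ofReal_norm]
    · rw [Set.indicator_of_notMem hξ, Set.indicator_of_notMem hξ, ENNReal.ofReal_zero]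
  rw [e1]
  refine ENNReal.ofReal_le_ofReal ?_
  -- A nonnegative integral equals the norm of its complex version, so the triangle inequality can
  -- be applied to the expanded double sum.
  have e2 : ∫ ξ, T.indicator (fun ξ => ‖G ξ‖ ^ 2) ξ =
      ‖∫ ξ, ((T.indicator (fun ξ => ‖G ξ‖ ^ 2) ξ : ℝ) : ℂ)‖ := by
    rw [integral_complex_ofReal, Complex.norm_real, Real.norm_of_nonneg (integral_nonneg hnn)]
  rw [e2]
  simp_rw [hexp]
  rw [integral_finsetSum _ fun n hn => integrable_finsetSum _ fun m hm => hQi n hn m hm]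
  have h1 : ‖∑ n ∈ frequencyBox d L, ∫ ξ, ∑ m ∈ frequencyBox d L,
      a n * (starRingEnd ℂ) (a m) * Q n m ξ‖ ≤ ∑ n ∈ frequencyBox d L, ∑ m ∈ frequencyBox d L,
        ‖a n‖ * ‖a m‖ * (if ∀ j, j ≠ i → n j = m j then 8 / M else 0) := by
    refine norm_sum_le_of_le _ fun n hn => ?_
    rw [integral_finsetSum _ fun m hm => hQi n hn m hm]
    refine norm_sum_le_of_le _ fun m hm => ?_
    rw [integral_const_mul, norm_mul, norm_mul, RCLike.norm_conj]
    exact mul_le_mul_of_nonneg_left (norm_integral_indicator_prod_fourier_le hM hLM i hn hm).2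
      (by positivity)
  refine h1.trans ?_
  have h2 := sum_sum_ite_mul_le (frequencyBox d L) (fun n m => ∀ j, j ≠ i → n j = m j)
    (fun n m h j hj => (h j hj).symm) (fun n _ => card_filter_frequencyBox_le L n i)
    (by positivity : 0 ≤ 8 / M) (fun n => ‖a n‖)
  push_cast at h2
  exact h2

end CubeTail

/-! ### Part (b): Voronoi weights of the integer lattice and the comparison of residuals. -/

section Lattice

variable {d : ℕ}

/-- The cube is invariant under sign changes of coordinates, so its polar norm depends monotonically
on the absolute values of the coordinates. This avoids computing the norm. -/
theorem gauge_polarSet_unitCube_mono (hD : IsCenteredSymmetricConvexBody (unitCube d))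
    {a b : EuclideanSpace ℝ (Fin d)} (hab : ∀ i, |a i| ≤ |b i|) :
    gauge (polarSet (unitCube d)) a ≤ gauge (polarSet (unitCube d)) b := by
  refine le_of_forall_pos_le_add fun δ hδ => ?_
  obtain ⟨t, ht0, ht, w, hw, rfl⟩ := exists_lt_of_gauge_lt
    (absorbent_nhds_zero (polarSet_mem_nhds_zero hD))
    (lt_add_of_pos_right (gauge (polarSet (unitCube d)) b) hδ)
  refine (gauge_le_of_mem ht0.le ⟨t⁻¹ • a, fun x hx => ?_, smul_inv_smul₀ ht0.ne' a⟩).trans ht.le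
  -- The signs of x are adjusted so that ⟨y, w⟩ is the sum of |x_i||w_i|, which dominates the
  -- pairing of x with any vector smaller than w in each coordinate.
  set y : EuclideanSpace ℝ (Fin d) := WithLp.toLp 2 fun i => if 0 ≤ w i then |x i| else -|x i| with hy
  have hyx : ∀ i, |y i| = |x i| := fun i => by
    simp only [hy]
    split_ifs <;> simp
  have hyD : y ∈ unitCube d := fun i => by
    have h1 : |x i| ≤ 1 / 2 := abs_le.2 ⟨by linarith [(hx i).1], (hx i).2⟩
    rw [← hyx] at h1
    have := abs_le.1 h1
    exact ⟨by linarith, this.2⟩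
  refine le_trans ?_ (hw y hyD)
  rw [PiLp.inner_apply, PiLp.inner_apply]
  refine Finset.sum_le_sum fun i _ => ?_
  have h2 : |a i| ≤ t * |w i| := by
    have := hab i
    simp only [PiLp.smul_apply, smul_eq_mul] at this
    rwa [abs_mul, abs_of_pos ht0] at this
  have h3 : y i * w i = |x i| * |w i| := by
    simp only [hy]
    split_ifs with h
    · rw [abs_of_nonneg h]
    · rw [abs_of_neg (not_le.1 h)]; ring
  have h4 : |t⁻¹ * a i| ≤ |w i| := by
    rw [abs_mul, abs_inv, abs_of_pos ht0, inv_mul_le_iff₀ ht0]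
    exact h2
  have h5 : x i * (t⁻¹ * a i) ≤ |x i| * |w i| :=
    (le_abs_self _).trans (by rw [abs_mul]; exact mul_le_mul_of_nonneg_left h4 (abs_nonneg _))
  simp only [PiLp.smul_apply, smul_eq_mul, RCLike.inner_apply, RCLike.conj_to_real]
  linarith

theorem volume_unitCube (d : ℕ) : volume (unitCube d) = 1 := by
  rw [← (PiLp.volume_preserving_toLp (Fin d)).measure_preimage_emb
    (MeasurableEquiv.toLp 2 (Fin d → ℝ)).measurableEmbedding]
  have : WithLp.toLp 2 ⁻¹' unitCube d =
      Set.Icc (fun _ => (-1 / 2 : ℝ)) (fun _ : Fin d => (1 / 2 : ℝ)) := by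
    ext x; simp [unitCube, Pi.le_def, forall_and]
  rw [this, Real.volume_Icc_pi]
  norm_num

/-- The translated unit cube around a lattice point lies in its Voronoi region: there each
coordinate is at least as close to n_i as to any other integer. Only this lower bound on the weight
is needed. -/
theorem one_le_voronoiWeight_integerLattice (hD : IsCenteredSymmetricConvexBody (unitCube d))
    (n : Fin d → ℤ) :
    1 ≤ voronoiWeight (polarSet (unitCube d)) (integerLattice d) (latticePoint n) := by
  rw [← volume_unitCube d, ← measure_preimage_add_right volume (-latticePoint n) (unitCube d)]
  refine measure_mono fun z hz l hl hln => gauge_polarSet_unitCube_mono hD fun i => ?_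
  have hz' := hz i
  obtain ⟨k, hk⟩ := hl i
  simp only [PiLp.add_apply, PiLp.neg_apply, latticePoint_apply, PiLp.sub_apply] at hz' ⊢
  rw [hk]
  rcases eq_or_ne k (n i) with h | h
  · rw [h]
  · have h1 : (1 : ℝ) ≤ |((k - n i : ℤ) : ℝ)| := by
      exact_mod_cast Int.one_le_abs (sub_ne_zero.2 h)
    have h2 : |(n i : ℝ) - z i| ≤ 1 / 2 :=
      abs_le.2 ⟨by linarith [hz'.2], by linarith [hz'.1]⟩
    have h3 := abs_sub_abs_le_abs_sub ((k : ℝ) - n i) (z i - n i)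
    have h4 : (k : ℝ) - n i - (z i - n i) = k - z i := by ring
    rw [h4, abs_sub_comm (z i) (n i : ℝ)] at h3
    push_cast at h1
    linarith

theorem latticePoint_injective : Function.Injective (latticePoint (d := d)) := fun n m h => by
  funext i
  have := congrArg (fun x : EuclideanSpace ℝ (Fin d) => x i) h
  simpa using this

/-- The samples outside a frequency box are controlled by the sampling residual. -/
theorem tsum_notMem_frequencyBox_le (hD : IsCenteredSymmetricConvexBody (unitCube d))
    {R : Submodule ℂ (Lp ℂ 2 (volume : Measure (EuclideanSpace ℝ (Fin d))))}
    {f : Lp ℂ 2 (volume : Measure (EuclideanSpace ℝ (Fin d)))} (hf : f ∈ R) (hf1 : ‖f‖ = 1)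
    {K : ℝ} {L : ℕ} (hKL : K ≤ L) :
    ∑' n : {n : Fin d → ℤ // n ∉ frequencyBox d L}, ‖fourierFn f (latticePoint n)‖ₑ ^ 2 ≤
      samplingResidual (unitCube d) R (integerLattice d) K := by
  refine le_trans ?_ (le_iSup₂_of_le f hf (le_iSup_of_le hf1 le_rfl))
  have hmem : ∀ n : {n : Fin d → ℤ // n ∉ frequencyBox d L},
      latticePoint n.1 ∈ integerLattice d ∧ K < ‖latticePoint n.1‖ := fun ⟨n, hn⟩ => by
    refine ⟨fun i => ⟨n i, rfl⟩, ?_⟩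
    have h1 : ∃ i, (L : ℤ) < |n i| := by
      by_contra h
      push Not at h
      exact hn (Fintype.mem_piFinset.2 fun i => Finset.mem_Icc.2 (abs_le.1 (h i)))
    obtain ⟨i, hi⟩ := h1
    have h2 : (L : ℝ) < |(n i : ℝ)| := by exact_mod_cast hi
    have h3 := PiLp.norm_apply_le (latticePoint n) i
    rw [latticePoint_apply, Real.norm_eq_abs] at h3
    linarith
  set e : {n : Fin d → ℤ // n ∉ frequencyBox d L} →
      {ω : EuclideanSpace ℝ (Fin d) // ω ∈ integerLattice d ∧ K < ‖ω‖} :=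
    fun n => ⟨latticePoint n.1, hmem n⟩ with he
  have hinj : Function.Injective e := fun n m h =>
    Subtype.ext (latticePoint_injective (congrArg Subtype.val h))
  refine le_trans (ENNReal.tsum_le_tsum fun n => ?_) (ENNReal.tsum_comp_le_tsum_of_injective hinj
    fun ω : {ω : EuclideanSpace ℝ (Fin d) // ω ∈ integerLattice d ∧ K < ‖ω‖} =>
      voronoiWeight (polarSet (unitCube d)) (integerLattice d) ω.1 * ‖fourierFn f ω.1‖ₑ ^ 2)
  exact le_mul_of_one_le_left bot_le (one_le_voronoiWeight_integerLattice hD n.1)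

theorem enorm_add_sq_le (a b : ℂ) : ‖a + b‖ₑ ^ 2 ≤ 2 * ‖a‖ₑ ^ 2 + 2 * ‖b‖ₑ ^ 2 := by
  have h : ‖a + b‖ ^ 2 ≤ 2 * ‖a‖ ^ 2 + 2 * ‖b‖ ^ 2 := by
    have := norm_add_le a b
    nlinarith [sq_nonneg (‖a‖ - ‖b‖), norm_nonneg (a + b), norm_nonneg a, norm_nonneg b]
  have e : ∀ z : ℂ, ‖z‖ₑ ^ 2 = ENNReal.ofReal (‖z‖ ^ 2) := fun z => by
    rw [ENNReal.ofReal_pow (norm_nonneg _), ofReal_norm]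
  rw [e, e, e, show (2 : ℝ≥0∞) = ENNReal.ofReal 2 by simp, ← ENNReal.ofReal_mul (by norm_num),
    ← ENNReal.ofReal_mul (by norm_num), ← ENNReal.ofReal_add (by positivity) (by positivity)]
  exact ENNReal.ofReal_le_ofReal h

/-- The sharp factor √d is replaced by d + 1, which is positive also for d = 0. -/
theorem exists_lt_abs_of_lt_norm {M : ℝ} (hM : 0 < M) {ξ : EuclideanSpace ℝ (Fin d)}
    (hξ : (d + 1) * M < ‖ξ‖) : ∃ i, M < |ξ i| := by
  by_contra h
  push Not at h
  have h1 : ‖ξ‖ ^ 2 ≤ ((d + 1) * M) ^ 2 := by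
    rw [EuclideanSpace.norm_sq_eq]
    calc ∑ i, ‖ξ i‖ ^ 2 ≤ ∑ _i : Fin d, M ^ 2 := Finset.sum_le_sum fun i _ => by
          rw [Real.norm_eq_abs]; exact pow_le_pow_left₀ (abs_nonneg _) (h i) 2
      _ = d * M ^ 2 := by simp
      _ ≤ ((d + 1) * M) ^ 2 := by
          have : (0 : ℝ) ≤ d := Nat.cast_nonneg d
          nlinarith [mul_nonneg this (sq_nonneg M), mul_nonneg (mul_nonneg this this) (sq_nonneg M)]
  have h2 := abs_le_of_sq_le_sq h1 (by positivity)
  linarith [le_abs_self ‖ξ‖]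

/-- The intrinsic residual on the cube in terms of the sampling residual of the integer lattice,
at a proportional frequency. -/
theorem intrinsicResidual_unitCube_le (hD : IsCenteredSymmetricConvexBody (unitCube d))
    {R : Submodule ℂ (Lp ℂ 2 (volume : Measure (EuclideanSpace ℝ (Fin d))))}
    (hR : R ≤ L2On (unitCube d)) {K M : ℝ} {L : ℕ} (hKL : K ≤ L) (hM : 0 < M)
    (hLM : 2 * (L : ℝ) ≤ M) :
    intrinsicResidual R ((d + 1) * M) ≤
      2 * samplingResidual (unitCube d) R (integerLattice d) K +
        2 * ENNReal.ofReal (d * (8 / M * (2 * L + 1))) := by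
  refine iSup₂_le fun f hf => iSup_le fun hf1 => ?_
  have hfD : f ∈ L2On (unitCube d) := hR hf
  have hfi := integrable_of_mem_L2On hD.isCompact hfD
  have hf2 := Lp.memLp f
  set F := frequencyBox d L with hF
  set a : (Fin d → ℤ) → ℂ := fun n => fourierFn f (latticePoint n) with ha
  -- After this subtraction ĥ vanishes at the lattice points of the box and agrees with f̂ at the
  -- others, so Parseval bounds ‖h‖² by the sampling residual.
  set h : EuclideanSpace ℝ (Fin d) → ℂ := fun x => f x - ∑ n ∈ F, a n * cubeExp n x with hh
  set G : EuclideanSpace ℝ (Fin d) → ℂ := fun ξ => ∑ n ∈ F, a n * 𝓕 (cubeExp n) ξ with hG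
  have hsumi : Integrable fun x => ∑ n ∈ F, a n * cubeExp n x :=
    integrable_finsetSum _ fun n _ => (integrable_cubeExp n).const_mul _
  have hhi : Integrable h := hfi.sub hsumi
  have hh2 : MemLp h 2 := hf2.sub (memLp_finsetSum _ fun n _ => (memLp_cubeExp n).const_mul _)
  have hhD : ∀ᵐ x, x ∉ unitCube d → h x = 0 := by
    filter_upwards [show ∀ᵐ x, x ∉ unitCube d → f x = 0 from hfD] with x hx hxD
    rw [hh]
    simp only
    rw [hx hxD, Finset.sum_eq_zero fun n _ => by rw [cubeExp_eq_zero n hxD, mul_zero], sub_zero]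
  have hfour : ∀ ξ, 𝓕 h ξ = fourierFn f ξ - G ξ := fun ξ => by
    have e1 : ∀ g : EuclideanSpace ℝ (Fin d) → ℂ, 𝓕 g ξ =
        ∫ x, Complex.exp ((-2 * Real.pi * inner ℝ x ξ : ℝ) * Complex.I) * g x := fun g => by
      rw [Real.fourier_eq']; rfl
    rw [fourierFn, hG]
    simp only [e1]
    have e2 : ∀ x, Complex.exp ((-2 * Real.pi * inner ℝ x ξ : ℝ) * Complex.I) * h x =
        Complex.exp ((-2 * Real.pi * inner ℝ x ξ : ℝ) * Complex.I) * f x -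
        ∑ n ∈ F, a n *
          (Complex.exp ((-2 * Real.pi * inner ℝ x ξ : ℝ) * Complex.I) * cubeExp n x) := fun x => by
      rw [hh, mul_sub, Finset.mul_sum]
      exact congrArg _ (Finset.sum_congr rfl fun n _ => by ring)
    have hei : ∀ n, Integrable fun x => a n *
        (Complex.exp ((-2 * Real.pi * inner ℝ x ξ : ℝ) * Complex.I) * cubeExp n x) := fun n =>
      (integrable_exp_inner_mul (integrable_cubeExp n) ξ).const_mul _
    simp_rw [e2]
    rw [integral_sub (integrable_exp_inner_mul hfi ξ) (integrable_finsetSum _ fun n _ => hei n),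
      integral_finsetSum _ fun n _ => hei n]
    simp_rw [integral_const_mul]
  have hhn : ∀ n, 𝓕 h (latticePoint n) = if n ∈ F then 0 else a n := fun n => by
    rw [hfour, hG]
    simp only [fourier_cubeExp_latticePoint, mul_ite, mul_one, mul_zero]
    rw [Finset.sum_ite_eq' F n a]
    split_ifs
    · exact sub_self _
    · exact sub_zero _
  have hhs : ∫⁻ ξ, ‖𝓕 h ξ‖ₑ ^ 2 ≤ samplingResidual (unitCube d) R (integerLattice d) K := by
    rw [lintegral_enorm_sq_fourier hhi hh2, ← tsum_enorm_sq_fourier_latticePoint hh2 hhD]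
    refine le_trans (le_of_eq ?_) (tsum_notMem_frequencyBox_le hD hf hf1 hKL)
    refine Eq.trans ?_ (tsum_subtype {n : Fin d → ℤ | n ∉ F} fun n => ‖a n‖ₑ ^ 2).symm
    refine tsum_congr fun n => ?_
    rw [hhn]
    by_cases hn : n ∈ F
    · rw [if_pos hn, Set.indicator_of_notMem (by exact fun h => h hn)]; simp
    · rw [if_neg hn, Set.indicator_of_mem (by exact hn)]
  have hasum : ∑ n ∈ F, ‖a n‖ ^ 2 ≤ 1 := by
    have h1 := tsum_enorm_sq_fourier_latticePoint hf2 hfD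
    rw [lintegral_enorm_sq_coeFn_of_norm_eq_one hf1] at h1
    have h2 : ∑ n ∈ F, ‖a n‖ₑ ^ 2 ≤ 1 := by
      rw [← h1]; exact ENNReal.sum_le_tsum F
    have h3 : ∑ n ∈ F, ‖a n‖ₑ ^ 2 = ENNReal.ofReal (∑ n ∈ F, ‖a n‖ ^ 2) := by
      rw [ENNReal.ofReal_sum_of_nonneg fun n _ => by positivity]
      refine Finset.sum_congr rfl fun n _ => ?_
      rw [ENNReal.ofReal_pow (norm_nonneg _), ofReal_norm]
    rw [h3] at h2
    exact ENNReal.ofReal_le_one.1 h2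
  have hGT : ∫⁻ ξ in {ξ : EuclideanSpace ℝ (Fin d) | (d + 1) * M < ‖ξ‖}, ‖G ξ‖ₑ ^ 2 ≤
      ENNReal.ofReal (d * (8 / M * (2 * L + 1))) := by
    have hsub : {ξ : EuclideanSpace ℝ (Fin d) | (d + 1) * M < ‖ξ‖} ⊆
        ⋃ i : Fin d, {ξ : EuclideanSpace ℝ (Fin d) | M < |ξ i|} := fun ξ hξ =>
      Set.mem_iUnion.2 (exists_lt_abs_of_lt_norm hM hξ)
    refine (lintegral_mono_set hsub).trans ((lintegral_iUnion_le _ _).trans ?_)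
    rw [tsum_fintype]
    calc _ ≤ ∑ _i : Fin d, ENNReal.ofReal (8 / M * (2 * L + 1)) :=
          Finset.sum_le_sum fun i _ =>
            (setLIntegral_enorm_sq_sum_fourier_cubeExp_le hM hLM i a).trans
              (ENNReal.ofReal_le_ofReal (mul_le_of_le_one_right (by positivity) hasum))
      _ = _ := by
          rw [Finset.sum_const, Finset.card_univ, Fintype.card_fin, nsmul_eq_mul,
            ENNReal.ofReal_mul (Nat.cast_nonneg d), ENNReal.ofReal_natCast]
  have hhm : Measurable fun ξ => ‖𝓕 h ξ‖ₑ ^ 2 :=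
    (continuous_fourier_of_integrable hhi).enorm.measurable.pow_const 2
  calc ∫⁻ ξ in {ξ : EuclideanSpace ℝ (Fin d) | (d + 1) * M < ‖ξ‖}, ‖fourierFn f ξ‖ₑ ^ 2
      ≤ ∫⁻ ξ in {ξ : EuclideanSpace ℝ (Fin d) | (d + 1) * M < ‖ξ‖},
          (2 * ‖𝓕 h ξ‖ₑ ^ 2 + 2 * ‖G ξ‖ₑ ^ 2) := lintegral_mono fun ξ => by
        have := enorm_add_sq_le (𝓕 h ξ) (G ξ)
        have e : 𝓕 h ξ + G ξ = fourierFn f ξ := by rw [hfour, sub_add_cancel]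
        rwa [e] at this
    _ = 2 * (∫⁻ ξ in {ξ : EuclideanSpace ℝ (Fin d) | (d + 1) * M < ‖ξ‖}, ‖𝓕 h ξ‖ₑ ^ 2) +
        2 * ∫⁻ ξ in {ξ : EuclideanSpace ℝ (Fin d) | (d + 1) * M < ‖ξ‖}, ‖G ξ‖ₑ ^ 2 := by
        rw [lintegral_add_left (hhm.const_mul 2), lintegral_const_mul _ hhm,
          lintegral_const_mul' _ _ (by simp)]
    _ ≤ _ := add_le_add (mul_le_mul' le_rfl ((setLIntegral_le_lintegral _ _).trans hhs))
        (mul_le_mul' le_rfl hGT)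

/-- The box has L = ⌈c N^α⌉ and the cutoff M is a multiple l of N^α, so (2L + 1)/M is of order (2c +
3)/l uniformly in N. -/
theorem hasResidualDecay_of_integerLattice (hD : IsCenteredSymmetricConvexBody (unitCube d))
    {R : ℕ → Submodule ℂ (Lp ℂ 2 (volume : Measure (EuclideanSpace ℝ (Fin d))))}
    (hR : ∀ N : ℕ, 1 ≤ N → R N ≤ L2On (unitCube d)) {α : ℝ} (hα : 0 < α)
    (h : HasResidualDecayWrt (unitCube d) R (integerLattice d) α) : HasResidualDecay R α := by
  intro θ hθ
  obtain ⟨c, hc0, hcs⟩ := h (θ / 4) (by positivity)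
  have hd : (0 : ℝ) ≤ d := Nat.cast_nonneg d
  -- The first summand ensures 2L ≤ M, and the second makes the partial-sum error d · 8(2c + 3)/l at
  -- most θ/4. With the residual also at most θ/4 and a factor 2 on each, the total is θ.
  set l : ℝ := 2 * (c + 1) + 32 * d * (2 * c + 3) / θ with hl
  have hl1 : 2 * (c + 1) ≤ l := le_add_of_nonneg_right (by positivity)
  have hl2 : 32 * d * (2 * c + 3) / θ ≤ l := le_add_of_nonneg_left (by positivity)
  have hl0 : 0 < l := by positivity
  refine ⟨(d + 1) * l, by positivity, iSup₂_le fun N hN => ?_⟩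
  set X : ℝ := (N : ℝ) ^ α with hX
  have hX1 : 1 ≤ X := Real.one_le_rpow (by exact_mod_cast hN) hα.le
  have hL : (⌈c * X⌉₊ : ℝ) ≤ (c + 1) * X := by
    have := Nat.ceil_lt_add_one (by positivity : 0 ≤ c * X)
    linarith
  rw [mul_assoc]
  have h1 := intrinsicResidual_unitCube_le hD (hR N hN) (Nat.le_ceil (c * X)) (M := l * X)
    (by positivity) (by nlinarith)
  refine h1.trans ?_
  have h2 := (le_iSup₂ (f := fun N (_ : 1 ≤ N) =>
    samplingResidual (unitCube d) (R N) (integerLattice d) (c * (N : ℝ) ^ α)) N hN).trans hcs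
  refine (add_le_add (mul_le_mul' le_rfl h2) le_rfl).trans ?_
  rw [show (2 : ℝ≥0∞) = ENNReal.ofReal 2 by simp, ← ENNReal.ofReal_mul (by norm_num),
    ← ENNReal.ofReal_mul (by norm_num), ← ENNReal.ofReal_add (by positivity) (by positivity)]
  refine ENNReal.ofReal_le_ofReal ?_
  have h3 : 8 / (l * X) * (2 * (⌈c * X⌉₊ : ℝ) + 1) ≤ 8 * (2 * c + 3) / l := by
    rw [div_mul_eq_mul_div, div_le_div_iff₀ (by positivity) hl0]
    have : 2 * (⌈c * X⌉₊ : ℝ) + 1 ≤ (2 * c + 3) * X := by linarith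
    nlinarith [mul_le_mul_of_nonneg_left this hl0.le]
  have h4 : d * (8 * (2 * c + 3) / l) ≤ θ / 4 := by
    rw [← mul_div_assoc, div_le_iff₀ hl0]
    rw [div_le_iff₀ hθ] at hl2
    linarith
  have h5 := mul_le_mul_of_nonneg_left h3 hd
  linarith

end Lattice
theorem corollary1p5 {d : ℕ} (D : Set (EuclideanSpace ℝ (Fin d)))
    (hD : IsCenteredSymmetricConvexBody D)
    (R : ℕ → Submodule ℂ (Lp ℂ 2 (volume : Measure (EuclideanSpace ℝ (Fin d)))))
    (hR : ∀ N : ℕ, 1 ≤ N → R N ≤ L2On D) (α : ℝ) (hα : 0 < α) :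
    (∀ Ω : Set (EuclideanSpace ℝ (Fin d)), IsClosed Ω → Ω.Countable →
      gap (polarSet D) Ω < 1 / 4 →
      HasResidualDecayWrt D R Ω α → HasResidualDecay R α) ∧
    (D = unitCube d →
      HasResidualDecayWrt D R (integerLattice d) α → HasResidualDecay R α) := by
  refine ⟨fun Ω hΩ hc hgap h => hasResidualDecay_of_gap_lt hD hR hα hΩ hc hgap h, ?_⟩
  rintro rfl h
  exact hasResidualDecay_of_integerLattice hD hR hα h
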